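/- Let $\mathbb R_+=(0,\infty)$, $\mathbb R_-=(-\infty,0)$, let $P_\pm$ be the orthogonal projections of $L^2(\mathbb R,dx)$ onto $L^2(\mathbb R_\pm)$, and identify bounded functions with multiplication operators. Let $\mathrm{Conf}(\mathbb R)$ be the space of configurations (locally finite subsets $X\subset\mathbb R$), with the $\sigma$-algebra generated by the maps $X\mapsto\#(X\cap B)$, $B$ bounded Borel. Let $K:\mathbb R\times\mathbb R\to\mathbb C$ be a measurable kernel that is $J$-Hermitian: it is the integral kernel of a bounded linear operator on $L^2(\mathbb R)$, also denoted $K$, and $K(x,y)=\mathrm{sgn}(x)\,\mathrm{sgn}(y)\,\overline{K(y,x)}$ for all $x,y\neq0$. Assume: (1) The operators $P_+KP_+$ and $P_-KP_-$ are non-negative. For all bounded Borel sets $\Delta_1\subset\mathbb R_+$ and $\Delta_2\subset\mathbb R_-$ the operators $\chi_{\Delta_i}K\chi_{\Delta_i}$ ($i=1,2$) are of trace class and $\chi_{\Delta_2}K\chi_{\Delta_1}$ is Hilbert--Schmidt; as usual for locally trace class operators, the diagonal of the kernel is normalised so that $\operatorname{tr}(\chi_{\Delta_i}K\chi_{\Delta_i})=\int_{\Delta_i}K(x,x)\,dx$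 for all such $\Delta_i$. The operator $\widehat K=\mathrm{sgn}\cdot K+\chi_{\mathbb R_-}$ is an orthogonal projection on $L^2(\mathbb R)$. (2) $\int_{|x|\le R}K(x,x)\,dx<\infty$ for every $R>0$, and there are $M>0$ and a non-negative function $\Phi\in L^1(\mathbb R)$ with $\int_{|t|\ge R}\Phi(t)\,dt=O(R^{-1})$ as $R\to\infty$ such that $|K(x,y)|^2\le\Phi(x-y)$ whenever $|x|\ge M$ and $|y|\ge M$. Let $\mathbb P_K$ be the determinantal point process on $\mathbb R$ with correlation kernel $K$, i.e. the probability measure on $\mathrm{Conf}(\mathbb R)$ such that for every $k\ge1$ and all pairwise disjoint bounded Borel sets $D_1,\dots,D_k\subset\mathbb R$ $$\int\prod_{i=1}^k\#(X\cap D_i)\,\mathbb P_K(dX)=\int_{D_1\times\cdots\times D_k}\det\bigl(K(x_i,x_j)\bigr)_{i,j=1}^k\,dx_1\cdots dx_k .$$ Then for every bounded Borel set $B\subset\mathbb R$ there is a measurable function $N_B^{out}:\mathrm{Conf}(\mathbb R)\to\mathbb Z$ such that for $\mathbb P_K$-almost every $X$ $$\#(B\cap X\cap\mathbb R_+)-\#(B\cap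 X\cap\mathbb R_-)=N_B^{out}(X\setminus B).$$ -/

import Mathlib

open MeasureTheory Filter Asymptotics
open scoped ENNReal InnerProductSpace ComplexConjugate

noncomputable section

namespace BalancedRigidity

/-! ### Trace class and Hilbert–Schmidt operators -/

section Operators

variable {H : Type*} [NormedAddCommGroup H] [InnerProductSpace ℂ H] [CompleteSpace H]

/-- `A` is Hilbert–Schmidt: `∑ ‖A eᵢ‖² < ∞` in every orthonormal basis. (A Hilbert basis may
always be indexed by its own range, so index types `s : Set H` suffice, and at least one exists.) -/
def IsHilbertSchmidt (A : H →L[ℂ] H) : Prop :=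
  ∀ (s : Set H) (b : HilbertBasis s ℂ H), Summable fun i => ‖A (b i)‖ ^ 2

/-- `A` is trace class: `∑ ⟨eᵢ, |A| eᵢ⟩ < ∞` in every orthonormal basis, `|A| = (A* A)^{1/2}`. -/
def IsTraceClass (A : H →L[ℂ] H) : Prop :=
  ∀ (s : Set H) (b : HilbertBasis s ℂ H), Summable fun i => ⟪b i, CFC.abs A (b i)⟫_ℂ

/-- `A` has trace `a`: `∑ ⟨eᵢ, A eᵢ⟩ = a` in every orthonormal basis. -/
def HasTrace (A : H →L[ℂ] H) (a : ℂ) : Prop :=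
  ∀ (s : Set H) (b : HilbertBasis s ℂ H), HasSum (fun i => ⟪b i, A (b i)⟫_ℂ) a

end Operators

/-! ### Operators on `L²(ℝ, dx)` -/

/-- The complex Hilbert space `L²(ℝ, dx)`. -/
abbrev L2 : Type := Lp ℂ 2 (volume : Measure ℝ)

/-- The multiplication operator `g ↦ f g` by an essentially bounded function `f`. -/
def mulOp (f : ℝ → ℂ) (hf : MemLp f ∞ volume) : L2 →L[ℂ] L2 :=
  (ContinuousLinearMap.mul ℂ ℂ).holderL volume ∞ 2 2 (hf.toLp f)

lemma memLp_chi {Δ : Set ℝ} (hΔ : MeasurableSet Δ) :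
    MemLp (Δ.indicator (1 : ℝ → ℂ)) ∞ volume :=
  (memLp_top_const (1 : ℂ)).indicator hΔ

/-- The operator of multiplication by the indicator function `χ_Δ`. -/
def chi (Δ : Set ℝ) (hΔ : MeasurableSet Δ) : L2 →L[ℂ] L2 :=
  mulOp (Δ.indicator 1) (memLp_chi hΔ)

/-- The orthogonal projection `P₊` onto `L²(ℝ₊)`. -/
def Pplus : L2 →L[ℂ] L2 := chi (Set.Ioi 0) measurableSet_Ioi

/-- The orthogonal projection `P₋` onto `L²(ℝ₋)`. -/
def Pminus : L2 →L[ℂ] L2 := chi (Set.Iio 0) measurableSet_Iio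

/-- The operator `J = P₊ - P₋`, i.e. multiplication by the sign function. -/
def J : L2 →L[ℂ] L2 := Pplus - Pminus

/-- `T̂ = sgn · T + χ_{ℝ₋}`. -/
def hat (T : L2 →L[ℂ] L2) : L2 →L[ℂ] L2 := J ∘L T + Pminus

/-- `K` is an integral kernel of the bounded operator `T` on `L²(ℝ)`. -/
structure IsIntegralKernel (K : ℝ → ℝ → ℂ) (T : L2 →L[ℂ] L2) : Prop where
  measurable : Measurable (Function.uncurry K)
  apply_ae : ∀ f : L2, ∀ᵐ x, Integrable (fun y => K x y * f y) ∧ T f x = ∫ y, K x y * f y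

/-- `K` is a `J`-Hermitian kernel with associated bounded operator `T`. -/
structure IsJHermitianKernel (K : ℝ → ℝ → ℂ) (T : L2 →L[ℂ] L2) : Prop extends
    IsIntegralKernel K T where
  symm : ∀ x y : ℝ, x ≠ 0 → y ≠ 0 →
    K x y = ((Real.sign x : ℝ) : ℂ) * ((Real.sign y : ℝ) : ℂ) * conj (K y x)

/-- The usual meaning of the diagonal `K(x,x)` of the kernel of a locally trace class operator.
The diagonal is Lebesgue null in the plane, so it is not determined by the operator itself; it is
normalised by `tr (χ_Δ T χ_Δ) = ∫_Δ K(x,x) dx` for bounded Borel `Δ ⊆ ℝ₊` and `Δ ⊆ ℝ₋`. -/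
def IsTraceDiagonal (K : ℝ → ℝ → ℂ) (T : L2 →L[ℂ] L2) : Prop :=
  ∀ (Δ : Set ℝ) (hΔ : MeasurableSet Δ), Bornology.IsBounded Δ →
    (Δ ⊆ Set.Ioi 0 ∨ Δ ⊆ Set.Iio 0) →
    IntegrableOn (fun x => K x x) Δ ∧
      HasTrace (chi Δ hΔ ∘L T ∘L chi Δ hΔ) (∫ x in Δ, K x x)

/-- First condition: positivity and local trace class properties of the diagonal blocks, local
Hilbert–Schmidt property of the off-diagonal block, and `T̂` is an orthogonal projection. -/
structure Condition1 (T : L2 →L[ℂ] L2) : Prop where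
  pos_plus : (Pplus ∘L T ∘L Pplus).IsPositive
  pos_minus : (Pminus ∘L T ∘L Pminus).IsPositive
  traceClass : ∀ (Δ : Set ℝ) (hΔ : MeasurableSet Δ), Bornology.IsBounded Δ →
    (Δ ⊆ Set.Ioi 0 ∨ Δ ⊆ Set.Iio 0) → IsTraceClass (chi Δ hΔ ∘L T ∘L chi Δ hΔ)
  hilbertSchmidt : ∀ (Δ₁ Δ₂ : Set ℝ) (h₁ : MeasurableSet Δ₁) (h₂ : MeasurableSet Δ₂),
    Bornology.IsBounded Δ₁ → Bornology.IsBounded Δ₂ → Δ₁ ⊆ Set.Ioi 0 → Δ₂ ⊆ Set.Iio 0 →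
    IsHilbertSchmidt (chi Δ₂ h₂ ∘L T ∘L chi Δ₁ h₁)
  projection : IsStarProjection (hat T)

/-- Second condition: the diagonal is locally integrable on `ℝ`, and off-diagonal decay. -/
structure Condition2 (K : ℝ → ℝ → ℂ) (M : ℝ) : Prop where
  diag_integrable : ∀ R : ℝ, 0 < R → IntegrableOn (fun x => K x x) {x | |x| ≤ R}
  decay : ∃ Φ : ℝ → ℝ, (∀ t, 0 ≤ Φ t) ∧ Integrable Φ ∧
    (fun R : ℝ => ∫ t in {t | R ≤ |t|}, Φ t) =O[atTop] (fun R : ℝ => R⁻¹) ∧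
    ∀ x y : ℝ, M ≤ |x| → M ≤ |y| → ‖K x y‖ ^ 2 ≤ Φ (x - y)

/-! ### Configurations and determinantal point processes -/

/-- A (simple) configuration on `ℝ`: a locally finite subset. -/
structure Conf where
  carrier : Set ℝ
  locallyFinite : ∀ C : Set ℝ, IsCompact C → (carrier ∩ C).Finite

/-- `#_B (X) = #(X ∩ B)`, used for bounded `B` only (then `X ∩ B` is finite). -/
def count (B : Set ℝ) (X : Conf) : ℕ := (X.carrier ∩ B).ncard

/-- The Borel structure of `Conf(ℝ)`: generated by the counting functions `#_B`, `B` bounded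
Borel. -/
instance : MeasurableSpace Conf :=
  ⨆ (B : Set ℝ) (_ : MeasurableSet B) (_ : Bornology.IsBounded B),
    MeasurableSpace.comap (count B) ⊤

/-- The configuration `X ∖ B`. -/
def Conf.diff (X : Conf) (B : Set ℝ) : Conf where
  carrier := X.carrier \ B
  locallyFinite C hC := (X.locallyFinite C hC).subset
    (Set.inter_subset_inter_left _ Set.sdiff_subset)

/-- The point process `P` is determinantal with correlation kernel `K` (with respect to Lebesgue
measure): `E ∏ #(X ∩ Dᵢ) = ∫_{D₁ × ⋯ × D_k} det (K(xᵢ, xⱼ)) dx` for disjoint bounded `Dᵢ`. -/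
structure IsDeterminantal (K : ℝ → ℝ → ℂ) (P : Measure Conf) : Prop where
  isProbabilityMeasure : IsProbabilityMeasure P
  correlation : ∀ (k : ℕ), 1 ≤ k → ∀ D : Fin k → Set ℝ,
    (∀ i, MeasurableSet (D i)) → (∀ i, Bornology.IsBounded (D i)) →
    Pairwise (fun i j => Disjoint (D i) (D j)) →
    Integrable (fun X => ∏ i, (count (D i) X : ℝ)) P ∧
    IntegrableOn (fun x : Fin k → ℝ => (Matrix.of fun i j => K (x i) (x j)).det)
      (Set.univ.pi D) ∧
    ((∫ X, ∏ i, (count (D i) X : ℝ) ∂P : ℝ) : ℂ) =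
      ∫ x in Set.univ.pi D, (Matrix.of fun i j => K (x i) (x j)).det

end BalancedRigidity

end

/-!
Give a configuration the charge `sgn`. For `h` of finite support, let `S(h)` be the total charge
of the configuration with `h(i)` as weight on the cell `[i, i + 1)`. The determinant formula
carries the sign `sgn(x) sgn(y)` in its two-point part, and it cancels against the charges:
distinct cells have covariance `-Aᵢⱼ`, where `Aᵢⱼ = ∫∫ |K(x, y)|²` over the product of the cells.
Since `T̂` is a projection, the total conductance `∑ⱼ Aᵢⱼ` is the expected number `∫ K(x, x) dx`
of points in the `i`-th cell, so `Var S(h)` is at most the Dirichlet form of `A` at `h`. The decay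
`∑_{|i - j| > k} Aᵢⱼ = O(1 / k)` bounds the energies of the trapezoidal cut-offs at scale `R`. As
`R → ∞` these converge weakly to the constant `1`, which has energy `0`, so suitable convex
combinations of them have arbitrarily small energy and equal `1` on any given finite set. If
`h = 1` on the cells meeting `B`, then the part of `S(h)` coming from `B` is the charge of `B`,
hence as `Var S(h) → 0` that charge is almost surely a limit of functions of `X ∖ B`.
-/

namespace BalancedRigidity

open scoped Topology

/-! ### Indicator and sign multipliers -/

lemma star_mul_self_of_mul_eq {R : Type*} [Ring R] [StarRing R] {h p t u : R}
    (hh : IsStarProjection h) (hp : IsSelfAdjoint p) (hu : star u * u = 1) (hpu : p * u = p)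
    (hhp : h * p = u * t * p) : p * t * p = star (t * p) * (t * p) := by
  have hsq : star (h * p) * (h * p) = p * (h * p) := by
    rw [star_mul, hh.isSelfAdjoint.star_eq, hp.star_eq, mul_assoc, ← mul_assoc h h p,
      hh.isIdempotentElem.eq]
  calc p * t * p = p * (h * p) := by rw [hhp, ← mul_assoc, ← mul_assoc, hpu]
    _ = star (u * (t * p)) * (u * (t * p)) := by rw [← hsq, hhp, mul_assoc]
    _ = star (t * p) * (star u * u) * (t * p) := by simp only [star_mul, mul_assoc]
    _ = star (t * p) * (t * p) := by rw [hu, mul_one]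

section Multipliers

variable {Δ Δ' : Set ℝ}

lemma chi_coeFn (hΔ : MeasurableSet Δ) (f : L2) :
    (chi Δ hΔ f : ℝ → ℂ) =ᵐ[volume] Δ.indicator f := by
  have h := (ContinuousLinearMap.mul ℂ ℂ).coeFn_holder (r := 2) (μ := volume)
    ((memLp_chi hΔ).toLp _) f
  filter_upwards [h, (memLp_chi hΔ).coeFn_toLp] with x hx hx'
  refine hx.trans ?_
  rw [hx']
  by_cases hxΔ : x ∈ Δ <;> simp [hxΔ]

lemma isSelfAdjoint_chi (hΔ : MeasurableSet Δ) : IsSelfAdjoint (chi Δ hΔ) := by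
  refine (ContinuousLinearMap.eq_adjoint_iff _ _).2 (fun f g => ?_) |>.symm
  rw [L2.inner_def, L2.inner_def]
  refine integral_congr_ae ?_
  filter_upwards [chi_coeFn hΔ f, chi_coeFn hΔ g] with x hf hg
  rw [hf, hg]
  by_cases hx : x ∈ Δ <;> simp [hx]

lemma chi_mul_chi (hΔ : MeasurableSet Δ) (hΔ' : MeasurableSet Δ') :
    chi Δ hΔ * chi Δ' hΔ' = chi (Δ ∩ Δ') (hΔ.inter hΔ') := by
  refine ContinuousLinearMap.ext fun f => Lp.ext ?_
  filter_upwards [chi_coeFn hΔ (chi Δ' hΔ' f), chi_coeFn hΔ' f,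
    chi_coeFn (hΔ.inter hΔ') f] with x h1 h2 h3
  rw [mul_apply_eq_comp, h1, h3, ← Set.indicator_indicator]
  by_cases hx : x ∈ Δ <;> simp only [hx, h2, Set.indicator_of_mem, Set.indicator_of_notMem,
    not_false_eq_true]

lemma chi_mul_chi_of_subset (hΔ : MeasurableSet Δ) (hΔ' : MeasurableSet Δ') (h : Δ' ⊆ Δ) :
    chi Δ hΔ * chi Δ' hΔ' = chi Δ' hΔ' := by
  simp only [chi_mul_chi, Set.inter_eq_right.2 h]

lemma chi_mul_chi_of_disjoint (hΔ : MeasurableSet Δ) (hΔ' : MeasurableSet Δ')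
    (h : Disjoint Δ Δ') : chi Δ hΔ * chi Δ' hΔ' = 0 := by
  simp only [chi_mul_chi, h.inter_eq]
  refine ContinuousLinearMap.ext fun f => Lp.ext ?_
  filter_upwards [chi_coeFn MeasurableSet.empty f, Lp.coeFn_zero ℂ 2 (volume : Measure ℝ)]
    with x h1 h2
  rw [h1, zero_apply, h2, Set.indicator_empty, Pi.zero_apply]

lemma Pplus_mul_Pplus : Pplus * Pplus = Pplus := chi_mul_chi_of_subset _ _ subset_rfl

lemma Pminus_mul_Pminus : Pminus * Pminus = Pminus := chi_mul_chi_of_subset _ _ subset_rfl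

lemma Pplus_mul_Pminus : Pplus * Pminus = 0 :=
  chi_mul_chi_of_disjoint _ _ Set.Ioi_disjoint_Iio_same

lemma Pminus_mul_Pplus : Pminus * Pplus = 0 :=
  chi_mul_chi_of_disjoint _ _ Set.Ioi_disjoint_Iio_same.symm

lemma Pplus_add_Pminus : Pplus + Pminus = 1 := by
  refine ContinuousLinearMap.ext fun f => Lp.ext ?_
  filter_upwards [Lp.coeFn_add (Pplus f) (Pminus f), chi_coeFn measurableSet_Ioi f,
    chi_coeFn measurableSet_Iio f, Measure.ae_ne volume 0] with x hadd hplus hminus hx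
  rw [add_apply, hadd, Pi.add_apply, Pplus, Pminus, hplus, hminus]
  rcases hx.lt_or_gt with hx | hx <;> simp [hx, hx.le]

lemma isSelfAdjoint_J : IsSelfAdjoint J :=
  (isSelfAdjoint_chi _).sub (isSelfAdjoint_chi _)

lemma J_mul_J : J * J = 1 := by
  rw [← Pplus_add_Pminus, J, sub_mul, mul_sub, mul_sub, Pplus_mul_Pplus, Pplus_mul_Pminus,
    Pminus_mul_Pplus, Pminus_mul_Pminus]
  abel

lemma chi_comp_comp_chi_eq_star_mul_self {T : L2 →L[ℂ] L2} (hT : IsStarProjection (hat T))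
    (hΔ : MeasurableSet Δ) (hside : Δ ⊆ Set.Ioi 0 ∨ Δ ⊆ Set.Iio 0) :
    chi Δ hΔ ∘L T ∘L chi Δ hΔ = star (T * chi Δ hΔ) * (T * chi Δ hΔ) := by
  have hsa := isSelfAdjoint_chi hΔ
  have hhat : hat T = J * T + Pminus := rfl
  change chi Δ hΔ * (T * chi Δ hΔ) = _
  rw [← mul_assoc]
  rcases hside with hpos | hneg
  · have hplus : chi Δ hΔ * Pplus = chi Δ hΔ := by
      simp only [Pplus, chi_mul_chi, Set.inter_eq_left.2 hpos]
    have hdisj : Disjoint (Set.Iio 0) Δ := Set.Ioi_disjoint_Iio_same.symm.mono_right hpos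
    refine star_mul_self_of_mul_eq hT hsa (u := J)
      (by rw [isSelfAdjoint_J.star_eq, J_mul_J]) ?_ ?_
    · rw [J, mul_sub, hplus, Pminus, chi_mul_chi_of_disjoint _ _ hdisj.symm, sub_zero]
    · rw [hhat, add_mul, Pminus, chi_mul_chi_of_disjoint _ _ hdisj, add_zero]
  · have hminus : chi Δ hΔ * Pminus = chi Δ hΔ := by
      simp only [Pminus, chi_mul_chi, Set.inter_eq_left.2 hneg]
    have hdisj : Disjoint Δ (Set.Ioi 0) := Set.Ioi_disjoint_Iio_same.symm.mono_left hneg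
    -- On the negative half-line it is the complementary projection `1 - hat T` that compresses.
    refine star_mul_self_of_mul_eq hT.one_sub hsa (u := -J)
      (by rw [star_neg, neg_mul_neg, isSelfAdjoint_J.star_eq, J_mul_J]) ?_ ?_
    · rw [J, neg_sub, mul_sub, hminus, Pplus, chi_mul_chi_of_disjoint _ _ hdisj, sub_zero]
    · rw [hhat, sub_mul, add_mul, one_mul, Pminus, chi_mul_chi_of_subset _ _ hneg, neg_mul,
        neg_mul]
      abel

lemma inner_chi_comp_comp_chi {T : L2 →L[ℂ] L2} (hT : IsStarProjection (hat T))
    (hΔ : MeasurableSet Δ) (hside : Δ ⊆ Set.Ioi 0 ∨ Δ ⊆ Set.Iio 0) (f : L2) :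
    ⟪f, (chi Δ hΔ ∘L T ∘L chi Δ hΔ) f⟫_ℂ = (‖T (chi Δ hΔ f)‖ ^ 2 : ℝ) := by
  rw [chi_comp_comp_chi_eq_star_mul_self hT hΔ hside, ContinuousLinearMap.star_eq_adjoint,
    mul_apply_eq_comp, ContinuousLinearMap.adjoint_inner_right,
    inner_self_eq_norm_sq_to_K, mul_apply_eq_comp, Complex.ofReal_pow]
  rfl

end Multipliers

/-! ### Hilbert–Schmidt norms of integral operators -/

lemma tsum_enorm_sq_le_of_orthonormal {H F : Type*} [NormedAddCommGroup H]
    [InnerProductSpace ℂ H] [CompleteSpace H] [NormedAddCommGroup F] {A : H → F} {c : ℝ≥0∞}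
    (hA : ∀ (s : Set H) (b : HilbertBasis s ℂ H), ∑' i, ‖A (b i)‖ₑ ^ 2 ≤ c)
    {ι : Type*} {e : ι → H} (he : Orthonormal ℂ e) : ∑' i, ‖A (e i)‖ₑ ^ 2 ≤ c := by
  obtain ⟨w, b, hw, hbw⟩ := he.toSubtypeRange.exists_hilbertBasis_extension
  let φ : ι → w := fun i => ⟨e i, hw ⟨i, rfl⟩⟩
  have hφ : Function.Injective φ := fun i j hij =>
    he.linearIndependent.injective (congrArg Subtype.val hij)
  calc ∑' i, ‖A (e i)‖ₑ ^ 2 = ∑' i, ‖A (b (φ i))‖ₑ ^ 2 := by simp only [hbw, φ]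
    _ ≤ ∑' k, ‖A (b k)‖ₑ ^ 2 :=
      ENNReal.tsum_comp_le_tsum_of_injective hφ fun k => ‖A (b k)‖ₑ ^ 2
    _ ≤ c := hA w b

section LpTwo

variable {α : Type*} [MeasurableSpace α] {μ : Measure α}

lemma eLpNorm_two_sq_eq_lintegral {F : Type*} [NormedAddCommGroup F] (f : α → F) :
    eLpNorm f 2 μ ^ 2 = ∫⁻ x, ‖f x‖ₑ ^ 2 ∂μ := by
  have h := eLpNorm_nnreal_pow_eq_lintegral (f := f) (μ := μ) (p := 2) two_ne_zero
  simpa only [NNReal.coe_ofNat, ENNReal.coe_ofNat, ENNReal.rpow_ofNat] using h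

lemma lintegral_enorm_sq_coeFn {F : Type*} [NormedAddCommGroup F] (f : Lp F 2 μ) :
    ∫⁻ x, ‖f x‖ₑ ^ 2 ∂μ = ‖f‖ₑ ^ 2 := by
  rw [Lp.enorm_def, eLpNorm_two_sq_eq_lintegral]

lemma tsum_enorm_sq_inner_le {H : Type*} [NormedAddCommGroup H] [InnerProductSpace ℂ H]
    {ι : Type*} {e : ι → H} (he : Orthonormal ℂ e) (u : H) :
    ∑' i, ‖⟪e i, u⟫_ℂ‖ₑ ^ 2 ≤ ‖u‖ₑ ^ 2 := by
  rw [ENNReal.tsum_eq_iSup_sum]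
  refine iSup_le fun s => ?_
  simp only [← ofReal_norm, ← ENNReal.ofReal_pow (norm_nonneg _)]
  rw [← ENNReal.ofReal_sum_of_nonneg fun i _ => by positivity]
  exact ENNReal.ofReal_le_ofReal (he.sum_inner_products_le u)

lemma tsum_enorm_integral_mul_sq_le {k : α → ℂ} (hk : AEStronglyMeasurable k μ)
    {ι : Type*} {e : ι → Lp ℂ 2 μ} (he : Orthonormal ℂ e) :
    ∑' i, ‖∫ y, k y * e i y ∂μ‖ₑ ^ 2 ≤ ∫⁻ y, ‖k y‖ₑ ^ 2 ∂μ := by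
  rcases eq_or_ne (∫⁻ y, ‖k y‖ₑ ^ 2 ∂μ) ∞ with htop | hfin
  · exact htop ▸ le_top
  rw [← eLpNorm_two_sq_eq_lintegral] at hfin ⊢
  have hk2 : MemLp (fun y => conj (k y)) 2 μ :=
    MemLp.star ⟨hk, (by simpa using hfin : eLpNorm k 2 μ ≠ ∞).lt_top⟩
  have hinner : ∀ i, ‖∫ y, k y * e i y ∂μ‖ₑ = ‖⟪e i, hk2.toLp⟫_ℂ‖ₑ := fun i => by
    rw [← inner_conj_symm, RCLike.enorm_conj, L2.inner_def]
    congr 1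
    refine integral_congr_ae ?_
    filter_upwards [hk2.coeFn_toLp] with y hy
    rw [hy, RCLike.inner_apply, Complex.conj_conj, mul_comm]
  have hnorm : eLpNorm k 2 μ = ‖hk2.toLp‖ₑ := by
    rw [Lp.enorm_def, eLpNorm_congr_ae hk2.coeFn_toLp]
    exact eLpNorm_congr_norm_ae (.of_forall fun y => (RCLike.norm_conj (k y)).symm)
  simp only [hinner, hnorm]
  exact tsum_enorm_sq_inner_le he _

end LpTwo

/-- The cell `[jδ, (j+1)δ)` of the grid of mesh `δ`. -/
def cell (δ : ℝ) (j : ℤ) : Set ℝ := Set.Ico (j * δ) ((j + 1) * δ)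

lemma measurableSet_cell (δ : ℝ) (j : ℤ) : MeasurableSet (cell δ j) := measurableSet_Ico

lemma isBounded_cell (δ : ℝ) (j : ℤ) : Bornology.IsBounded (cell δ j) := Metric.isBounded_Ico _ _

lemma volume_cell (δ : ℝ) (j : ℤ) : volume (cell δ j) = ENNReal.ofReal δ := by
  rw [cell, Real.volume_Ico]
  ring_nf

lemma volume_cell_ne_top (δ : ℝ) (j : ℤ) : volume (cell δ j) ≠ ∞ := by
  rw [volume_cell]
  exact ENNReal.ofReal_ne_top

lemma volume_real_cell {δ : ℝ} (hδ : 0 < δ) (j : ℤ) : volume.real (cell δ j) = δ := by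
  rw [Measure.real, volume_cell, ENNReal.toReal_ofReal hδ.le]

lemma mem_cell_iff {δ : ℝ} (hδ : 0 < δ) {j : ℤ} {y : ℝ} : y ∈ cell δ j ↔ ⌊y / δ⌋ = j := by
  rw [Int.floor_eq_iff, cell, Set.mem_Ico, le_div_iff₀ hδ, div_lt_iff₀ hδ]

lemma mem_cell_floor {δ : ℝ} (hδ : 0 < δ) (y : ℝ) : y ∈ cell δ ⌊y / δ⌋ :=
  (mem_cell_iff hδ).2 rfl

lemma pairwise_disjoint_cell {δ : ℝ} (hδ : 0 < δ) :
    Pairwise (Function.onFun Disjoint (cell δ)) := fun _ _ hij =>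
  Set.disjoint_left.2 fun _ hi hj => hij (((mem_cell_iff hδ).1 hi).symm.trans
    ((mem_cell_iff hδ).1 hj))

lemma iUnion_cell {δ : ℝ} (hδ : 0 < δ) : ⋃ j, cell δ j = Set.univ :=
  Set.eq_univ_of_forall fun y => Set.mem_iUnion.2 ⟨_, mem_cell_floor hδ y⟩

/-- The normalised indicator function of a cell, as a unit vector of `L²(ℝ)`. -/
noncomputable def cellFun (δ : ℝ) (j : ℤ) : L2 :=
  indicatorConstLp 2 (measurableSet_cell δ j) (volume_cell_ne_top δ j) (((√δ)⁻¹ : ℝ) : ℂ)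

lemma orthonormal_cellFun {δ : ℝ} (hδ : 0 < δ) : Orthonormal ℂ (cellFun δ) := by
  rw [orthonormal_iff_ite]
  intro i j
  rw [cellFun, cellFun, L2.inner_indicatorConstLp_indicatorConstLp _ _ (volume_cell_ne_top δ i)
    (volume_cell_ne_top δ j)]
  split_ifs with hij
  · subst hij
    rw [Set.inter_self, volume_real_cell hδ, RCLike.inner_apply, Complex.conj_ofReal]
    have hsqrt : δ * ((√δ)⁻¹ * (√δ)⁻¹) = 1 := by
      rw [← mul_inv, Real.mul_self_sqrt hδ.le, mul_inv_cancel₀ hδ.ne']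
    rw [Complex.real_smul]
    exact_mod_cast hsqrt
  · rw [(pairwise_disjoint_cell hδ hij).inter_eq, measureReal_empty, zero_smul]

lemma integral_mul_cellFun (k : ℝ → ℂ) (δ : ℝ) (j : ℤ) :
    ∫ y, k y * cellFun δ j y = (∫ y in cell δ j, k y) * (((√δ)⁻¹ : ℝ) : ℂ) := by
  rw [← integral_mul_const, ← integral_indicator (measurableSet_cell δ j)]
  refine integral_congr_ae ?_
  filter_upwards [indicatorConstLp_coeFn (p := 2) (hs := measurableSet_cell δ j)
    (hμs := volume_cell_ne_top δ j) (c := (((√δ)⁻¹ : ℝ) : ℂ))] with y hy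
  rw [cellFun, hy]
  by_cases h : y ∈ cell δ j <;> simp [h]

/-- The cellwise average of `k` over the grid of mesh `δ`: the conditional expectation of `k`
given the cells. -/
noncomputable def cellAvg (k : ℝ → ℂ) (δ : ℝ) (y : ℝ) : ℂ := ⨍ z in cell δ ⌊y / δ⌋, k z

lemma measurable_cellAvg (k : ℝ → ℂ) (δ : ℝ) : Measurable (cellAvg k δ) :=
  (measurable_from_top (f := fun j : ℤ => ⨍ z in cell δ j, k z)).comp
    (Int.measurable_floor.comp (measurable_id.div_const δ))

lemma ofReal_mul_enorm_setAverage_cell_sq (k : ℝ → ℂ) {δ : ℝ} (hδ : 0 < δ) (j : ℤ) :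
    ‖⨍ z in cell δ j, k z‖ₑ ^ 2 * ENNReal.ofReal δ = ‖∫ y, k y * cellFun δ j y‖ₑ ^ 2 := by
  have hsqrt : ‖(√δ : ℂ)‖ₑ ^ 2 = ENNReal.ofReal δ := by
    rw [← enorm_pow, ← Complex.ofReal_pow, Real.sq_sqrt hδ.le, ← ofReal_norm, Complex.norm_real,
      Real.norm_of_nonneg hδ.le]
  have hmul : (δ : ℂ)⁻¹ * √δ = (√δ : ℂ)⁻¹ := by
    exact_mod_cast (inv_mul_eq_div _ _).trans (Real.sqrt_div_self (x := δ))
  rw [← hsqrt, ← mul_pow, ← enorm_mul, integral_mul_cellFun, setAverage_eq, volume_real_cell hδ,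
    Complex.real_smul, mul_right_comm, Complex.ofReal_inv, hmul, mul_comm, Complex.ofReal_inv]

lemma lintegral_cellAvg_sq (k : ℝ → ℂ) {δ : ℝ} (hδ : 0 < δ) :
    ∫⁻ y, ‖cellAvg k δ y‖ₑ ^ 2 = ∑' j, ‖∫ y, k y * cellFun δ j y‖ₑ ^ 2 := by
  rw [← setLIntegral_univ, ← iUnion_cell hδ,
    lintegral_iUnion (measurableSet_cell δ) (pairwise_disjoint_cell hδ)]
  refine tsum_congr fun j => ?_
  rw [← ofReal_mul_enorm_setAverage_cell_sq k hδ, ← volume_cell δ j, ← setLIntegral_const]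
  exact setLIntegral_congr_fun (measurableSet_cell δ j) fun y hy => by
    simp only [cellAvg, (mem_cell_iff hδ).1 hy]

lemma ae_tendsto_cellAvg {k : ℝ → ℂ} (hk : LocallyIntegrable k) :
    ∀ᵐ y, Tendsto (fun δ => cellAvg k δ y) (𝓝[>] 0) (𝓝 (k y)) := by
  have hball (δ : ℝ) (j : ℤ) :
      Metric.closedBall ((j + 1 / 2) * δ) (δ / 2) = Set.Icc (j * δ) ((j + 1) * δ) := by
    rw [Real.closedBall_eq_Icc]
    congr 1 <;> ring
  filter_upwards [IsUnifLocDoublingMeasure.ae_tendsto_average (μ := volume) hk 1] with y hy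
  have hlim : Tendsto (fun δ : ℝ => δ / 2) (𝓝[>] 0) (𝓝[>] 0) :=
    tendsto_nhdsWithin_iff.2 ⟨by
      simpa using (tendsto_id (α := ℝ)).mono_left (nhdsWithin_le_nhds (a := 0)) |>.div_const 2,
      eventually_mem_nhdsWithin.mono fun δ hδ => half_pos (Set.mem_Ioi.1 hδ)⟩
  refine (hy (fun δ => (⌊y / δ⌋ + 1 / 2) * δ) _ hlim ?_).congr fun δ => ?_
  · filter_upwards [self_mem_nhdsWithin] with δ hδ
    rw [one_mul, hball]
    exact Set.Ico_subset_Icc_self (mem_cell_floor hδ y)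
  · rw [hball, cellAvg, setAverage_eq, setAverage_eq, cell, setIntegral_congr_set Ico_ae_eq_Icc,
      measureReal_congr Ico_ae_eq_Icc]

lemma lintegral_enorm_sq_le_liminf_cellFun {k : ℝ → ℂ} (hk : LocallyIntegrable k) :
    ∫⁻ y, ‖k y‖ₑ ^ 2 ≤ liminf (fun δ => ∑' j, ‖∫ y, k y * cellFun δ j y‖ₑ ^ 2)
      (𝓝[>] 0) := by
  calc ∫⁻ y, ‖k y‖ₑ ^ 2
      = ∫⁻ y, liminf (fun δ => ‖cellAvg k δ y‖ₑ ^ 2) (𝓝[>] 0) := by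
        refine lintegral_congr_ae ?_
        filter_upwards [ae_tendsto_cellAvg hk] with y hy
        exact ((ENNReal.continuous_pow 2).tendsto _ |>.comp hy.enorm).liminf_eq.symm
    _ ≤ liminf (fun δ => ∫⁻ y, ‖cellAvg k δ y‖ₑ ^ 2) (𝓝[>] 0) :=
        lintegral_liminf_le fun δ => (measurable_cellAvg k δ).enorm.pow_const 2
    _ = _ := liminf_congr <| eventually_mem_nhdsWithin.mono fun δ hδ => lintegral_cellAvg_sq k hδ

section IntegralKernel

variable {K : ℝ → ℝ → ℂ} {T : L2 →L[ℂ] L2} {Δ : Set ℝ}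

lemma IsIntegralKernel.ae_apply_chi (hK : IsIntegralKernel K T) (hΔ : MeasurableSet Δ) (f : L2) :
    ∀ᵐ x, T (chi Δ hΔ f) x = ∫ y, Δ.indicator (K x) y * f y := by
  filter_upwards [hK.apply_ae (chi Δ hΔ f)] with x hx
  rw [hx.2]
  refine integral_congr_ae ?_
  filter_upwards [chi_coeFn hΔ f] with y hy
  rw [hy]
  by_cases h : y ∈ Δ <;> simp [h]

lemma IsIntegralKernel.ae_integrable_indicator (hK : IsIntegralKernel K T) (hΔ : MeasurableSet Δ)
    (hfin : volume Δ ≠ ∞) : ∀ᵐ x, Integrable (Δ.indicator (K x)) := by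
  filter_upwards [hK.apply_ae (indicatorConstLp 2 hΔ hfin (1 : ℂ))] with x hx
  refine hx.1.congr ?_
  filter_upwards [indicatorConstLp_coeFn (p := 2) (hs := hΔ) (hμs := hfin) (c := (1 : ℂ))]
    with y hy
  rw [hy]
  by_cases h : y ∈ Δ <;> simp [h]

lemma IsIntegralKernel.enorm_sq_apply_chi (hK : IsIntegralKernel K T) (hΔ : MeasurableSet Δ)
    (f : L2) :
    ‖T (chi Δ hΔ f)‖ₑ ^ 2 = ∫⁻ x, ‖∫ y, Δ.indicator (K x) y * f y‖ₑ ^ 2 := by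
  rw [← lintegral_enorm_sq_coeFn]
  refine lintegral_congr_ae ?_
  filter_upwards [hK.ae_apply_chi hΔ f] with x hx
  rw [hx]

lemma IsIntegralKernel.aemeasurable_enorm_sq_integral (hK : IsIntegralKernel K T)
    (hΔ : MeasurableSet Δ) (f : L2) :
    AEMeasurable (fun x => ‖∫ y, Δ.indicator (K x) y * f y‖ₑ ^ 2) := by
  refine ((Lp.stronglyMeasurable (T (chi Δ hΔ f))).measurable.enorm.pow_const 2).aemeasurable.congr
    ?_
  filter_upwards [hK.ae_apply_chi hΔ f] with x hx
  rw [hx]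

lemma lintegral_indicator_enorm_sq (hΔ : MeasurableSet Δ) (k : ℝ → ℂ) :
    ∫⁻ y, ‖Δ.indicator k y‖ₑ ^ 2 = ∫⁻ y in Δ, ‖k y‖ₑ ^ 2 := by
  rw [← lintegral_indicator hΔ]
  refine lintegral_congr fun y => ?_
  by_cases h : y ∈ Δ <;> simp [h]

lemma IsIntegralKernel.tsum_enorm_sq_le (hK : IsIntegralKernel K T) (hΔ : MeasurableSet Δ)
    {ι : Type*} {e : ι → L2} (he : Orthonormal ℂ e) :
    ∑' i, ‖T (chi Δ hΔ (e i))‖ₑ ^ 2 ≤ ∫⁻ x, ∫⁻ y in Δ, ‖K x y‖ₑ ^ 2 := by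
  rw [ENNReal.tsum_eq_iSup_sum]
  refine iSup_le fun s => ?_
  simp only [hK.enorm_sq_apply_chi]
  rw [← lintegral_finsetSum' _ fun i _ => hK.aemeasurable_enorm_sq_integral hΔ (e i)]
  refine lintegral_mono fun x => ?_
  have hmeas : Measurable (Δ.indicator (K x)) := hK.measurable.of_uncurry_left.indicator hΔ
  calc ∑ i ∈ s, ‖∫ y, Δ.indicator (K x) y * e i y‖ₑ ^ 2
      ≤ ∑' i, ‖∫ y, Δ.indicator (K x) y * e i y‖ₑ ^ 2 := ENNReal.sum_le_tsum s
    _ ≤ ∫⁻ y, ‖Δ.indicator (K x) y‖ₑ ^ 2 :=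
      tsum_enorm_integral_mul_sq_le hmeas.aestronglyMeasurable he
    _ = ∫⁻ y in Δ, ‖K x y‖ₑ ^ 2 := lintegral_indicator_enorm_sq hΔ _

lemma IsIntegralKernel.lintegral_enorm_sq_le (hK : IsIntegralKernel K T) (hΔ : MeasurableSet Δ)
    (hfin : volume Δ ≠ ∞) {c : ℝ≥0∞}
    (hc : ∀ δ, 0 < δ → ∑' j, ‖T (chi Δ hΔ (cellFun δ j))‖ₑ ^ 2 ≤ c) :
    ∫⁻ x, ∫⁻ y in Δ, ‖K x y‖ₑ ^ 2 ≤ c := by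
  have hmeas := fun δ j => hK.aemeasurable_enorm_sq_integral hΔ (cellFun δ j)
  calc ∫⁻ x, ∫⁻ y in Δ, ‖K x y‖ₑ ^ 2
      ≤ ∫⁻ x, liminf (fun δ => ∑' j, ‖∫ y, Δ.indicator (K x) y * cellFun δ j y‖ₑ ^ 2)
          (𝓝[>] 0) := by
        refine lintegral_mono_ae ?_
        filter_upwards [hK.ae_integrable_indicator hΔ hfin] with x hx
        rw [← lintegral_indicator_enorm_sq hΔ]
        exact lintegral_enorm_sq_le_liminf_cellFun hx.locallyIntegrable
    _ ≤ liminf (fun δ => ∫⁻ x, ∑' j, ‖∫ y, Δ.indicator (K x) y * cellFun δ j y‖ₑ ^ 2)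
          (𝓝[>] 0) :=
        lintegral_liminf_le' fun δ => AEMeasurable.tsum fun j => hmeas δ j
    _ = liminf (fun δ => ∑' j, ‖T (chi Δ hΔ (cellFun δ j))‖ₑ ^ 2) (𝓝[>] 0) := by
        simp only [lintegral_tsum fun j => hmeas _ j, hK.enorm_sq_apply_chi]
    _ ≤ c := by
        refine liminf_le_of_frequently_le' (Eventually.frequently ?_)
        filter_upwards [self_mem_nhdsWithin] with δ hδ using hc δ hδ

lemma IsTraceDiagonal.hasSum_norm_sq (hdiag : IsTraceDiagonal K T)
    (hT : IsStarProjection (hat T)) (hΔ : MeasurableSet Δ) (hb : Bornology.IsBounded Δ)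
    (hside : Δ ⊆ Set.Ioi 0 ∨ Δ ⊆ Set.Iio 0) {s : Set L2} (b : HilbertBasis s ℂ L2) :
    HasSum (fun i => ‖T (chi Δ hΔ (b i))‖ ^ 2) (∫ x in Δ, K x x).re := by
  have htrace := (hdiag Δ hΔ hb hside).2 s b
  simp only [inner_chi_comp_comp_chi hT hΔ hside] at htrace
  exact_mod_cast Complex.hasSum_re htrace

lemma IsTraceDiagonal.tsum_enorm_sq_eq (hdiag : IsTraceDiagonal K T)
    (hT : IsStarProjection (hat T)) (hΔ : MeasurableSet Δ) (hb : Bornology.IsBounded Δ)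
    (hside : Δ ⊆ Set.Ioi 0 ∨ Δ ⊆ Set.Iio 0) {s : Set L2} (b : HilbertBasis s ℂ L2) :
    ∑' i, ‖T (chi Δ hΔ (b i))‖ₑ ^ 2 = ENNReal.ofReal (∫ x in Δ, K x x).re := by
  have hsum := hdiag.hasSum_norm_sq hT hΔ hb hside b
  rw [← hsum.tsum_eq, ENNReal.ofReal_tsum_of_nonneg (fun _ => by positivity) hsum.summable]
  exact tsum_congr fun i => by rw [ENNReal.ofReal_pow (norm_nonneg _), ofReal_norm]

lemma IsTraceDiagonal.re_integral_nonneg_of_one_sided (hdiag : IsTraceDiagonal K T)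
    (hT : IsStarProjection (hat T)) (hΔ : MeasurableSet Δ) (hb : Bornology.IsBounded Δ)
    (hside : Δ ⊆ Set.Ioi 0 ∨ Δ ⊆ Set.Iio 0) : 0 ≤ (∫ x in Δ, K x x).re := by
  obtain ⟨w, b, -⟩ := exists_hilbertBasis ℂ L2
  exact (hdiag.hasSum_norm_sq hT hΔ hb hside b).nonneg fun _ => by positivity

lemma IsTraceDiagonal.lintegral_enorm_sq_of_one_sided (hdiag : IsTraceDiagonal K T)
    (hK : IsIntegralKernel K T) (hT : IsStarProjection (hat T)) (hΔ : MeasurableSet Δ)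
    (hb : Bornology.IsBounded Δ) (hside : Δ ⊆ Set.Ioi 0 ∨ Δ ⊆ Set.Iio 0) :
    ∫⁻ x, ∫⁻ y in Δ, ‖K x y‖ₑ ^ 2 = ENNReal.ofReal (∫ x in Δ, K x x).re := by
  refine le_antisymm (hK.lintegral_enorm_sq_le hΔ hb.measure_lt_top.ne fun δ hδ => ?_) ?_
  · exact tsum_enorm_sq_le_of_orthonormal (A := fun f => T (chi Δ hΔ f))
      (fun s b => (hdiag.tsum_enorm_sq_eq hT hΔ hb hside b).le) (orthonormal_cellFun hδ)
  · obtain ⟨w, b, -⟩ := exists_hilbertBasis ℂ L2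
    rw [← hdiag.tsum_enorm_sq_eq hT hΔ hb hside b]
    exact hK.tsum_enorm_sq_le hΔ b.orthonormal

lemma restrict_eq_restrict_Ioi_add_restrict_Iio (hΔ : MeasurableSet Δ) :
    (volume : Measure ℝ).restrict Δ =
      volume.restrict (Δ ∩ Set.Ioi 0) + volume.restrict (Δ ∩ Set.Iio 0) := by
  have hdisj : Disjoint (Δ ∩ Set.Ioi 0) (Δ ∩ Set.Iio 0) :=
    Set.Ioi_disjoint_Iio_same.mono Set.inter_subset_right Set.inter_subset_right
  rw [← Measure.restrict_union hdisj (hΔ.inter measurableSet_Iio), ← Set.inter_union_distrib_left]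
  refine Measure.restrict_congr_set ?_
  filter_upwards [Measure.ae_ne volume 0] with x hx
  exact propext ⟨fun hmem => ⟨hmem, hx.lt_or_gt.symm⟩, And.left⟩

lemma IsTraceDiagonal.integrableOn (hdiag : IsTraceDiagonal K T) (hΔ : MeasurableSet Δ)
    (hb : Bornology.IsBounded Δ) : IntegrableOn (fun x => K x x) Δ := by
  rw [IntegrableOn, restrict_eq_restrict_Ioi_add_restrict_Iio hΔ]
  exact integrable_add_measure.2
    ⟨(hdiag _ (hΔ.inter measurableSet_Ioi) (hb.subset Set.inter_subset_left)
      (.inl Set.inter_subset_right)).1,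
    (hdiag _ (hΔ.inter measurableSet_Iio) (hb.subset Set.inter_subset_left)
      (.inr Set.inter_subset_right)).1⟩

lemma IsTraceDiagonal.re_integral_nonneg (hdiag : IsTraceDiagonal K T)
    (hT : IsStarProjection (hat T)) (hΔ : MeasurableSet Δ) (hb : Bornology.IsBounded Δ) :
    0 ≤ (∫ x in Δ, K x x).re := by
  have hpos := hΔ.inter (measurableSet_Ioi (a := (0 : ℝ)))
  have hneg := hΔ.inter (measurableSet_Iio (a := (0 : ℝ)))
  have hbpos := hb.subset (Set.inter_subset_left (t := Set.Ioi 0))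
  have hbneg := hb.subset (Set.inter_subset_left (t := Set.Iio 0))
  rw [restrict_eq_restrict_Ioi_add_restrict_Iio hΔ, integral_add_measure
    (hdiag.integrableOn hpos hbpos) (hdiag.integrableOn hneg hbneg), Complex.add_re]
  exact add_nonneg
    (hdiag.re_integral_nonneg_of_one_sided hT hpos hbpos (.inl Set.inter_subset_right))
    (hdiag.re_integral_nonneg_of_one_sided hT hneg hbneg (.inr Set.inter_subset_right))

lemma IsTraceDiagonal.lintegral_enorm_sq (hdiag : IsTraceDiagonal K T)
    (hK : IsIntegralKernel K T) (hT : IsStarProjection (hat T)) (hΔ : MeasurableSet Δ)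
    (hb : Bornology.IsBounded Δ) :
    ∫⁻ x, ∫⁻ y in Δ, ‖K x y‖ₑ ^ 2 = ENNReal.ofReal (∫ x in Δ, K x x).re := by
  have hpos := hΔ.inter (measurableSet_Ioi (a := (0 : ℝ)))
  have hneg := hΔ.inter (measurableSet_Iio (a := (0 : ℝ)))
  have hbpos := hb.subset (Set.inter_subset_left (t := Set.Ioi 0))
  have hbneg := hb.subset (Set.inter_subset_left (t := Set.Iio 0))
  have hrow : Measurable fun x => ∫⁻ y in Δ ∩ Set.Ioi 0, ‖K x y‖ₑ ^ 2 :=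
    (hK.measurable.enorm.pow_const 2).lintegral_prod_right'
  rw [restrict_eq_restrict_Ioi_add_restrict_Iio hΔ, integral_add_measure
    (hdiag.integrableOn hpos hbpos) (hdiag.integrableOn hneg hbneg), Complex.add_re,
    ENNReal.ofReal_add
      (hdiag.re_integral_nonneg_of_one_sided hT hpos hbpos (.inl Set.inter_subset_right))
      (hdiag.re_integral_nonneg_of_one_sided hT hneg hbneg (.inr Set.inter_subset_right)),
    ← hdiag.lintegral_enorm_sq_of_one_sided hK hT hpos hbpos (.inl Set.inter_subset_right),
    ← hdiag.lintegral_enorm_sq_of_one_sided hK hT hneg hbneg (.inr Set.inter_subset_right),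
    ← lintegral_add_left hrow]
  simp only [lintegral_add_measure]

end IntegralKernel

/-! ### Block energies of a `J`-Hermitian kernel -/

/-- The energy `∫∫_{D × D'} |K(x, y)|² dx dy` of a block of the kernel, i.e. the squared
Hilbert–Schmidt norm of `χ_D K χ_{D'}`. -/
noncomputable def energy (K : ℝ → ℝ → ℂ) (D D' : Set ℝ) : ℝ := ∫ z in D ×ˢ D', ‖K z.1 z.2‖ ^ 2

/-- The function `sgn x sgn y |K(x, y)|²` on the plane. For a `J`-Hermitian kernel it is the product
`K(x, y) K(y, x)` occurring in the two-point correlation function. -/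
noncomputable def signedSq (K : ℝ → ℝ → ℂ) (z : ℝ × ℝ) : ℝ :=
  Real.sign z.1 * Real.sign z.2 * ‖K z.1 z.2‖ ^ 2

lemma measurable_sign : Measurable Real.sign :=
  Measurable.ite measurableSet_Iio measurable_const
    (Measurable.ite measurableSet_Ioi measurable_const measurable_const)

lemma integrableOn_Ioi_Iio_quadrants {f : ℝ × ℝ → ℝ} {D D' : Set ℝ}
    (hf : IntegrableOn f (D ×ˢ D')) :
    IntegrableOn f ((D ∩ Set.Ioi 0) ×ˢ (D' ∩ Set.Ioi 0)) ∧
      IntegrableOn f ((D ∩ Set.Ioi 0) ×ˢ (D' ∩ Set.Iio 0)) ∧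
      IntegrableOn f ((D ∩ Set.Iio 0) ×ˢ (D' ∩ Set.Ioi 0)) ∧
      IntegrableOn f ((D ∩ Set.Iio 0) ×ˢ (D' ∩ Set.Iio 0)) := by
  refine ⟨?_, ?_, ?_, ?_⟩ <;>
    exact hf.mono_set (Set.prod_mono Set.inter_subset_left Set.inter_subset_left)

lemma setIntegral_prod_eq_add_quadrants {f : ℝ × ℝ → ℝ} {D D' : Set ℝ} (hD : MeasurableSet D)
    (hD' : MeasurableSet D') (hf : IntegrableOn f (D ×ˢ D')) :
    ∫ z in D ×ˢ D', f z =
      ((∫ z in (D ∩ Set.Ioi 0) ×ˢ (D' ∩ Set.Ioi 0), f z) +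
        ∫ z in (D ∩ Set.Ioi 0) ×ˢ (D' ∩ Set.Iio 0), f z) +
      ((∫ z in (D ∩ Set.Iio 0) ×ˢ (D' ∩ Set.Ioi 0), f z) +
        ∫ z in (D ∩ Set.Iio 0) ×ˢ (D' ∩ Set.Iio 0), f z) := by
  obtain ⟨hpp, hpm, hmp, hmm⟩ := integrableOn_Ioi_Iio_quadrants hf
  simp only [IntegrableOn, Measure.volume_eq_prod, ← Measure.prod_restrict] at hpp hpm hmp hmm ⊢
  rw [restrict_eq_restrict_Ioi_add_restrict_Iio hD,
    restrict_eq_restrict_Ioi_add_restrict_Iio hD', Measure.add_prod, Measure.prod_add,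
    Measure.prod_add, integral_add_measure (hpp.add_measure hpm) (hmp.add_measure hmm),
    integral_add_measure hpp hpm, integral_add_measure hmp hmm]

lemma energy_eq_add_quadrants {K : ℝ → ℝ → ℂ} {D D' : Set ℝ} (hD : MeasurableSet D)
    (hD' : MeasurableSet D')
    (hint : IntegrableOn (fun z : ℝ × ℝ => ‖K z.1 z.2‖ ^ 2) (D ×ˢ D')) :
    energy K D D' =
      (energy K (D ∩ Set.Ioi 0) (D' ∩ Set.Ioi 0) + energy K (D ∩ Set.Ioi 0) (D' ∩ Set.Iio 0)) +
      (energy K (D ∩ Set.Iio 0) (D' ∩ Set.Ioi 0) + energy K (D ∩ Set.Iio 0) (D' ∩ Set.Iio 0)) :=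
  setIntegral_prod_eq_add_quadrants hD hD' hint

lemma setIntegral_signedSq {K : ℝ → ℝ → ℂ} {D D' : Set ℝ} {s s' : ℝ} (hD : MeasurableSet D)
    (hD' : MeasurableSet D') (hs : ∀ x ∈ D, Real.sign x = s) (hs' : ∀ x ∈ D', Real.sign x = s') :
    ∫ z in D ×ˢ D', signedSq K z = s * s' * energy K D D' := by
  rw [energy, ← integral_const_mul]
  refine setIntegral_congr_fun (hD.prod hD') fun z hz => ?_
  simp only [signedSq, hs _ hz.1, hs' _ hz.2]

section JHermitian

variable {K : ℝ → ℝ → ℂ} {T : L2 →L[ℂ] L2} {D D' : Set ℝ}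

lemma IsJHermitianKernel.norm_symm (hK : IsJHermitianKernel K T) {x y : ℝ} (hx : x ≠ 0)
    (hy : y ≠ 0) : ‖K x y‖ = ‖K y x‖ := by
  rw [hK.symm x y hx hy]
  rcases Real.sign_apply_eq_of_ne_zero x hx with h | h <;>
  rcases Real.sign_apply_eq_of_ne_zero y hy with h' | h' <;> simp [h, h']

lemma IsJHermitianKernel.mul_swap (hK : IsJHermitianKernel K T) {x y : ℝ} (hx : x ≠ 0)
    (hy : y ≠ 0) : K x y * K y x = (signedSq K (x, y) : ℂ) := by
  have hnorm : K x y * conj (K x y) = ((‖K x y‖ ^ 2 : ℝ) : ℂ) := by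
    rw [Complex.mul_conj, Complex.normSq_eq_norm_sq]
  rw [hK.symm y x hy hx, signedSq]
  push_cast at hnorm ⊢
  rw [← hnorm]
  ring

lemma ae_ne_zero_prod : ∀ᵐ z : ℝ × ℝ, z.1 ≠ 0 ∧ z.2 ≠ 0 :=
  (Measure.quasiMeasurePreserving_fst.ae (Measure.ae_ne volume 0)).and
    (Measure.quasiMeasurePreserving_snd.ae (Measure.ae_ne volume 0))

lemma energy_nonneg (K : ℝ → ℝ → ℂ) (D D' : Set ℝ) : 0 ≤ energy K D D' :=
  integral_nonneg fun _ => by positivity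

lemma IsJHermitianKernel.energy_comm (hK : IsJHermitianKernel K T) (D D' : Set ℝ) :
    energy K D D' = energy K D' D := by
  rw [energy, energy, Measure.volume_eq_prod,
    ← setIntegral_prod_swap D D' fun z : ℝ × ℝ => ‖K z.1 z.2‖ ^ 2]
  refine integral_congr_ae (ae_restrict_of_ae ?_)
  filter_upwards [ae_ne_zero_prod] with z hz
  simp only [Prod.fst_swap, Prod.snd_swap, hK.norm_symm hz.1 hz.2]

lemma IsIntegralKernel.measurable_norm_sq (hK : IsIntegralKernel K T) :
    Measurable fun z : ℝ × ℝ => ‖K z.1 z.2‖ ^ 2 := hK.measurable.norm.pow_const 2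

lemma IsTraceDiagonal.integrableOn_norm_sq (hdiag : IsTraceDiagonal K T)
    (hK : IsIntegralKernel K T) (hT : IsStarProjection (hat T)) (D : Set ℝ)
    (hD' : MeasurableSet D') (hb' : Bornology.IsBounded D') :
    IntegrableOn (fun z : ℝ × ℝ => ‖K z.1 z.2‖ ^ 2) (D ×ˢ D') := by
  suffices IntegrableOn (fun z : ℝ × ℝ => ‖K z.1 z.2‖ ^ 2) (Set.univ ×ˢ D') from
    this.mono_set (Set.prod_mono_left (Set.subset_univ _))
  refine ⟨hK.measurable_norm_sq.aestronglyMeasurable, ?_⟩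
  rw [HasFiniteIntegral, Measure.volume_eq_prod, ← Measure.prod_restrict,
    lintegral_prod _ hK.measurable_norm_sq.enorm.aemeasurable, Measure.restrict_univ]
  simp only [enorm_pow, enorm_norm]
  rw [hdiag.lintegral_enorm_sq hK hT hD' hb']
  exact ENNReal.ofReal_lt_top

lemma IsTraceDiagonal.integrableOn_signedSq (hdiag : IsTraceDiagonal K T)
    (hK : IsIntegralKernel K T) (hT : IsStarProjection (hat T)) (D : Set ℝ)
    (hD' : MeasurableSet D') (hb' : Bornology.IsBounded D') :
    IntegrableOn (signedSq K) (D ×ˢ D') := by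
  refine (hdiag.integrableOn_norm_sq hK hT D hD' hb').bdd_mul (c := 1)
    ((measurable_sign.comp measurable_fst).mul
      (measurable_sign.comp measurable_snd)).aestronglyMeasurable
    (Eventually.of_forall fun z => ?_)
  rcases Real.sign_apply_eq z.1 with h | h | h <;>
  rcases Real.sign_apply_eq z.2 with h' | h' | h' <;> simp [h, h']

lemma IsTraceDiagonal.ofReal_energy (hdiag : IsTraceDiagonal K T)
    (hK : IsIntegralKernel K T) (hT : IsStarProjection (hat T)) (D : Set ℝ)
    (hD' : MeasurableSet D') (hb' : Bornology.IsBounded D') :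
    ENNReal.ofReal (energy K D D') = ∫⁻ x in D, ∫⁻ y in D', ‖K x y‖ₑ ^ 2 := by
  rw [energy, ofReal_integral_eq_lintegral_ofReal (hdiag.integrableOn_norm_sq hK hT D hD' hb')
    (Eventually.of_forall fun _ => by positivity), Measure.volume_eq_prod, ← Measure.prod_restrict,
    lintegral_prod _ hK.measurable_norm_sq.ennreal_ofReal.aemeasurable]
  simp only [ENNReal.ofReal_pow (norm_nonneg _), ofReal_norm]

end JHermitian

/-! ### Second moments of counting functions -/

section Counting

variable {D D' : Set ℝ}

lemma measurable_count (hD : MeasurableSet D) (hb : Bornology.IsBounded D) :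
    Measurable (count D) := by
  have hle : MeasurableSpace.comap (count D) ⊤ ≤ (inferInstance : MeasurableSpace Conf) :=
    le_iSup_of_le D (le_iSup_of_le hD (le_iSup_of_le hb le_rfl))
  exact fun s _ => hle _ ⟨s, trivial, rfl⟩

lemma measurable_natCast_count (hD : MeasurableSet D) (hb : Bornology.IsBounded D) :
    Measurable fun X => (count D X : ℝ) :=
  (measurable_from_top (f := fun n : ℕ => (n : ℝ))).comp (measurable_count hD hb)

lemma Conf.finite_inter (X : Conf) (hb : Bornology.IsBounded D) : (X.carrier ∩ D).Finite := by
  obtain ⟨r, hr⟩ := hb.subset_closedBall 0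
  exact (X.locallyFinite _ (isCompact_closedBall 0 r)).subset (Set.inter_subset_inter_right _ hr)

lemma count_eq_sum_cell (X : Conf) (hb : Bornology.IsBounded D) {δ : ℝ} (hδ : 0 < δ)
    {t : Finset ℤ} (ht : ∀ y ∈ D, ⌊y / δ⌋ ∈ t) :
    count D X = ∑ j ∈ t, count (D ∩ cell δ j) X := by
  classical
  have hfin := X.finite_inter hb
  have hmem : ∀ {y}, y ∈ hfin.toFinset ↔ y ∈ X.carrier ∩ D := hfin.mem_toFinset
  rw [count, Set.ncard_eq_toFinset_card _ hfin,
    Finset.card_eq_sum_card_fiberwise (f := fun y => ⌊y / δ⌋) (t := t)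
      fun y hy => ht y (hmem.1 hy).2]
  refine Finset.sum_congr rfl fun j _ => ?_
  rw [count, ← Set.ncard_coe_finset]
  congr 1
  ext y
  simp only [Finset.coe_filter, hmem, Set.mem_inter_iff, mem_cell_iff hδ, and_assoc,
    Set.mem_ofPred_eq]

lemma exists_finset_floor_div_mem (hb : Bornology.IsBounded D) {δ : ℝ} (hδ : 0 < δ) :
    ∃ t : Finset ℤ, ∀ y ∈ D, ⌊y / δ⌋ ∈ t := by
  obtain ⟨r, hr⟩ := hb.subset_closedBall 0
  refine ⟨Finset.Icc ⌊-r / δ⌋ ⌊r / δ⌋, fun y hy => ?_⟩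
  have hy' : |y| ≤ r := by simpa using hr hy
  exact Finset.mem_Icc.2 ⟨Int.floor_mono (by gcongr; exact neg_le_of_abs_le hy'),
    Int.floor_mono (by gcongr; exact le_of_abs_le hy')⟩

lemma eventually_floor_div_ne {x y : ℝ} (hxy : x ≠ y) :
    ∀ᶠ δ : ℝ in 𝓝[>] 0, ⌊x / δ⌋ ≠ ⌊y / δ⌋ := by
  filter_upwards [Ioo_mem_nhdsGT (abs_pos.2 (sub_ne_zero.2 hxy))] with δ hδ heq
  have hlt := Int.abs_sub_lt_one_of_floor_eq_floor heq
  rw [← sub_div, abs_div, abs_of_pos hδ.1, div_lt_one hδ.1] at hlt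
  exact hlt.not_gt hδ.2

lemma eventually_count_inter_cell_le_one (X : Conf) (hb : Bornology.IsBounded D) :
    ∀ᶠ δ in 𝓝[>] 0, ∀ j, count (D ∩ cell δ j) X ≤ 1 := by
  have hfin := X.finite_inter hb
  have hsep : ∀ᶠ δ : ℝ in 𝓝[>] 0, ∀ x ∈ X.carrier ∩ D, ∀ y ∈ X.carrier ∩ D, x ≠ y →
      ⌊x / δ⌋ ≠ ⌊y / δ⌋ :=
    (eventually_all_finite hfin).2 fun x _ => (eventually_all_finite hfin).2 fun y _ =>
      eventually_imp_distrib_left.2 eventually_floor_div_ne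
  filter_upwards [hsep, self_mem_nhdsWithin] with δ hδsep hδ j
  refine (Set.ncard_le_one (X.finite_inter (hb.subset Set.inter_subset_left))).2 ?_
  rintro a ⟨haX, haD, haj⟩ b ⟨hbX, hbD, hbj⟩
  rw [mem_cell_iff hδ] at haj hbj
  by_contra hab
  exact hδsep a ⟨haX, haD⟩ b ⟨hbX, hbD⟩ hab (haj.trans hbj.symm)

lemma eventually_count_add_sum_offDiag_eq_sq (X : Conf) (hb : Bornology.IsBounded D)
    {t : ℝ → Finset ℤ} (ht : ∀ δ, 0 < δ → ∀ y ∈ D, ⌊y / δ⌋ ∈ t δ) :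
    ∀ᶠ δ in 𝓝[>] 0, (count D X : ℝ) +
      ∑ p ∈ (t δ).offDiag, (count (D ∩ cell δ p.1) X : ℝ) * count (D ∩ cell δ p.2) X =
        (count D X : ℝ) ^ 2 := by
  filter_upwards [eventually_count_inter_cell_le_one X hb, self_mem_nhdsWithin] with δ hone hδ
  have hsum : (count D X : ℝ) = ∑ j ∈ t δ, (count (D ∩ cell δ j) X : ℝ) := by
    exact_mod_cast count_eq_sum_cell X hb hδ (ht δ hδ)
  have hidem (j : ℤ) :
      (count (D ∩ cell δ j) X : ℝ) * count (D ∩ cell δ j) X = count (D ∩ cell δ j) X := by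
    rcases Nat.le_one_iff_eq_zero_or_eq_one.1 (hone j) with h | h <;> simp [h]
  have hdiag : ∑ p ∈ (t δ).diag, (count (D ∩ cell δ p.1) X : ℝ) * count (D ∩ cell δ p.2) X =
      count D X := by
    rw [Finset.sum_diag, hsum]
    exact Finset.sum_congr rfl fun j _ => hidem j
  rw [← hdiag, ← Finset.sum_union (Finset.disjoint_diag_offDiag _), Finset.diag_union_offDiag,
    hdiag, sq, hsum, Finset.sum_mul_sum, Finset.sum_product]

end Counting

section OffDiagonal

variable {G : ℝ × ℝ → ℝ} {D : Set ℝ}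

lemma sum_offDiag_setIntegral_cell {δ : ℝ} (hδ : 0 < δ) {t : Finset ℤ}
    (ht : ∀ y ∈ D, ⌊y / δ⌋ ∈ t) (hD : MeasurableSet D) (hG : IntegrableOn G (D ×ˢ D)) :
    ∑ p ∈ t.offDiag, ∫ z in (D ∩ cell δ p.1) ×ˢ (D ∩ cell δ p.2), G z =
      ∫ z in D ×ˢ D ∩ {z | ⌊z.1 / δ⌋ ≠ ⌊z.2 / δ⌋}, G z := by
  have hunion : D ×ˢ D ∩ {z : ℝ × ℝ | ⌊z.1 / δ⌋ ≠ ⌊z.2 / δ⌋} =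
      ⋃ p ∈ t.offDiag, (D ∩ cell δ p.1) ×ˢ (D ∩ cell δ p.2) := by
    ext ⟨x, y⟩
    simp only [Set.mem_inter_iff, Set.mem_prod, Set.mem_ofPred_eq, Set.mem_iUnion,
      mem_cell_iff hδ, Finset.mem_offDiag, exists_prop, Prod.exists]
    constructor
    · rintro ⟨⟨hx, hy⟩, hxy⟩
      exact ⟨_, _, ⟨ht x hx, ht y hy, hxy⟩, ⟨hx, rfl⟩, hy, rfl⟩
    · rintro ⟨i, j, ⟨-, -, hij⟩, ⟨hx, rfl⟩, hy, rfl⟩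
      exact ⟨⟨hx, hy⟩, hij⟩
  have hcell (j : ℤ) : MeasurableSet (D ∩ cell δ j) := hD.inter (measurableSet_cell δ j)
  rw [hunion, integral_biUnion_finset _ fun p _ => (hcell p.1).prod (hcell p.2)]
  · rintro ⟨i, j⟩ - ⟨i', j'⟩ - hne
    refine Set.disjoint_left.2 ?_
    rintro ⟨x, y⟩ ⟨⟨-, hx⟩, -, hy⟩ ⟨⟨-, hx'⟩, -, hy'⟩
    rw [mem_cell_iff hδ] at hx hy hx' hy'
    exact hne (Prod.ext (hx.symm.trans hx') (hy.symm.trans hy'))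
  · exact fun p _ => hG.mono_set (Set.prod_mono Set.inter_subset_left Set.inter_subset_left)

lemma ae_fst_ne_snd : ∀ᵐ z : ℝ × ℝ, z.1 ≠ z.2 := by
  have hmeas : MeasurableSet {z : ℝ × ℝ | z.1 ≠ z.2} :=
    (measurableSet_eq_fun measurable_fst measurable_snd).compl
  rw [Measure.volume_eq_prod, Measure.ae_prod_iff_ae_ae hmeas]
  exact Eventually.of_forall fun x => (Measure.ae_ne volume x).mono fun y hy => hy.symm

lemma tendsto_setIntegral_floor_div_ne (hG : IntegrableOn G (D ×ˢ D)) :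
    Tendsto (fun δ => ∫ z in D ×ˢ D ∩ {z | ⌊z.1 / δ⌋ ≠ ⌊z.2 / δ⌋}, G z) (𝓝[>] 0)
      (𝓝 (∫ z in D ×ˢ D, G z)) := by
  have hset (δ : ℝ) : MeasurableSet {z : ℝ × ℝ | ⌊z.1 / δ⌋ ≠ ⌊z.2 / δ⌋} :=
    (measurableSet_eq_fun (Int.measurable_floor.comp (measurable_fst.div_const _))
      (Int.measurable_floor.comp (measurable_snd.div_const _))).compl
  simp_rw [← setIntegral_indicator (hset _)]
  refine tendsto_integral_filter_of_dominated_convergence (fun z => ‖G z‖)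
    (Eventually.of_forall fun δ => hG.1.indicator (hset δ))
    (Eventually.of_forall fun δ => Eventually.of_forall fun z => norm_indicator_le_norm_self _ _)
    hG.norm ?_
  filter_upwards [ae_restrict_of_ae ae_fst_ne_snd] with z hz
  refine tendsto_const_nhds.congr' ?_
  filter_upwards [eventually_floor_div_ne hz] with δ hδ
  exact (Set.indicator_of_mem (s := {z : ℝ × ℝ | ⌊z.1 / δ⌋ ≠ ⌊z.2 / δ⌋}) hδ G).symm

end OffDiagonal

lemma integrable_and_integral_le_of_tendsto {α ι : Type*} [MeasurableSpace α] {μ : Measure α}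
    {l : Filter ι} [l.NeBot] [l.IsCountablyGenerated] {f : α → ℝ} {u : ι → α → ℝ} {c : ι → ℝ}
    {a : ℝ} (hf : AEStronglyMeasurable f μ) (hf0 : 0 ≤ f) (hu : ∀ i, AEMeasurable (u i) μ)
    (hu0 : ∀ i, 0 ≤ u i) (hle : ∀ᶠ i in l, Integrable (u i) μ ∧ ∫ x, u i x ∂μ ≤ c i)
    (huf : ∀ x, Tendsto (fun i => u i x) l (𝓝 (f x))) (hc : Tendsto c l (𝓝 a)) :
    Integrable f μ ∧ ∫ x, f x ∂μ ≤ a := by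
  have ha : 0 ≤ a :=
    ge_of_tendsto hc (hle.mono fun i hi => (integral_nonneg (hu0 i)).trans hi.2)
  have hfatou : ∫⁻ x, ENNReal.ofReal (f x) ∂μ ≤ ENNReal.ofReal a := calc
    ∫⁻ x, ENNReal.ofReal (f x) ∂μ = ∫⁻ x, liminf (fun i => ENNReal.ofReal (u i x)) l ∂μ :=
      lintegral_congr fun x => ((ENNReal.tendsto_ofReal (huf x)).liminf_eq).symm
    _ ≤ liminf (fun i => ∫⁻ x, ENNReal.ofReal (u i x) ∂μ) l :=
      lintegral_liminf_le' fun i => (hu i).ennreal_ofReal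
    _ ≤ liminf (fun i => ENNReal.ofReal (c i)) l := by
      refine liminf_le_liminf (hle.mono fun i hi => ?_)
      rw [← ofReal_integral_eq_lintegral_ofReal hi.1 (Eventually.of_forall (hu0 i))]
      exact ENNReal.ofReal_le_ofReal hi.2
    _ = ENNReal.ofReal a := (ENNReal.tendsto_ofReal hc).liminf_eq
  have hint : Integrable f μ := by
    refine ⟨hf, ?_⟩
    rw [hasFiniteIntegral_iff_ofReal (Eventually.of_forall hf0)]
    exact hfatou.trans_lt ENNReal.ofReal_lt_top
  rw [← ofReal_integral_eq_lintegral_ofReal hint (Eventually.of_forall hf0)] at hfatou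
  exact ⟨hint, (ENNReal.ofReal_le_ofReal_iff ha).1 hfatou⟩

/-- The point process `P` satisfies `E (#_D #_{D'}) = E #_D E #_{D'} - ∫_{D × D'} G` for disjoint
bounded `D` and `D'`: in the language of point processes, `-G` is the truncated two-point
correlation function of `P`. -/
structure HasClusterFunction (P : Measure Conf) (G : ℝ × ℝ → ℝ) : Prop where
  integrableOn : ∀ D D' : Set ℝ, MeasurableSet D' → Bornology.IsBounded D' →
    IntegrableOn G (D ×ˢ D')
  integrable_count : ∀ D : Set ℝ, MeasurableSet D → Bornology.IsBounded D →
    Integrable (fun X => (count D X : ℝ)) P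
  integrable_mul : ∀ D D' : Set ℝ, MeasurableSet D → Bornology.IsBounded D → MeasurableSet D' →
    Bornology.IsBounded D' → Disjoint D D' →
    Integrable (fun X => (count D X : ℝ) * count D' X) P
  integral_mul : ∀ D D' : Set ℝ, MeasurableSet D → Bornology.IsBounded D → MeasurableSet D' →
    Bornology.IsBounded D' → Disjoint D D' →
    ∫ X, (count D X : ℝ) * count D' X ∂P =
      (∫ X, (count D X : ℝ) ∂P) * (∫ X, (count D' X : ℝ) ∂P) - ∫ z in D ×ˢ D', G z

namespace HasClusterFunction

variable {P : Measure Conf} {G : ℝ × ℝ → ℝ} {D D' : Set ℝ}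

lemma sum_offDiag_integral_mul_le (h : HasClusterFunction P G) (hD : MeasurableSet D)
    (hb : Bornology.IsBounded D) {δ : ℝ} (hδ : 0 < δ) {t : Finset ℤ}
    (ht : ∀ y ∈ D, ⌊y / δ⌋ ∈ t) :
    ∑ p ∈ t.offDiag, (∫ X, (count (D ∩ cell δ p.1) X : ℝ) ∂P) *
      (∫ X, (count (D ∩ cell δ p.2) X : ℝ) ∂P) ≤ (∫ X, (count D X : ℝ) ∂P) ^ 2 := by
  have hsum : ∫ X, (count D X : ℝ) ∂P = ∑ j ∈ t, ∫ X, (count (D ∩ cell δ j) X : ℝ) ∂P := by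
    rw [← integral_finsetSum _ fun j _ => h.integrable_count _
      (hD.inter (measurableSet_cell δ j)) (hb.subset Set.inter_subset_left)]
    simp only [count_eq_sum_cell _ hb hδ ht, Nat.cast_sum]
  rw [sq, hsum, Finset.sum_mul_sum, ← Finset.sum_product']
  refine Finset.sum_le_sum_of_subset_of_nonneg (by grind) fun p _ _ => ?_
  exact mul_nonneg (integral_nonneg fun X => by positivity)
    (integral_nonneg fun X => by positivity)

lemma integral_count_add_sum_offDiag_le (h : HasClusterFunction P G) (hD : MeasurableSet D)
    (hb : Bornology.IsBounded D) {δ : ℝ} (hδ : 0 < δ) {t : Finset ℤ}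
    (ht : ∀ y ∈ D, ⌊y / δ⌋ ∈ t) :
    Integrable (fun X => (count D X : ℝ) +
        ∑ p ∈ t.offDiag, (count (D ∩ cell δ p.1) X : ℝ) * count (D ∩ cell δ p.2) X) P ∧
      ∫ X, (count D X : ℝ) +
        ∑ p ∈ t.offDiag, (count (D ∩ cell δ p.1) X : ℝ) * count (D ∩ cell δ p.2) X ∂P ≤
      (∫ X, (count D X : ℝ) ∂P) + (∫ X, (count D X : ℝ) ∂P) ^ 2 -
        ∫ z in D ×ˢ D ∩ {z | ⌊z.1 / δ⌋ ≠ ⌊z.2 / δ⌋}, G z := by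
  have hcell (j : ℤ) : MeasurableSet (D ∩ cell δ j) := hD.inter (measurableSet_cell δ j)
  have hcellb (j : ℤ) : Bornology.IsBounded (D ∩ cell δ j) := hb.subset Set.inter_subset_left
  have hdisj : ∀ p ∈ t.offDiag, Disjoint (D ∩ cell δ p.1) (D ∩ cell δ p.2) := fun p hp =>
    (pairwise_disjoint_cell hδ (Finset.mem_offDiag.1 hp).2.2).mono Set.inter_subset_right
      Set.inter_subset_right
  have hmul : ∀ p ∈ t.offDiag, Integrable
      (fun X => (count (D ∩ cell δ p.1) X : ℝ) * count (D ∩ cell δ p.2) X) P := fun p hp =>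
    h.integrable_mul _ _ (hcell _) (hcellb _) (hcell _) (hcellb _) (hdisj p hp)
  have hcount := h.integrable_count D hD hb
  refine ⟨hcount.add (integrable_finsetSum _ hmul), ?_⟩
  rw [integral_add hcount (integrable_finsetSum _ hmul), integral_finsetSum _ hmul,
    Finset.sum_congr rfl fun p hp => h.integral_mul _ _ (hcell _) (hcellb _) (hcell _) (hcellb _)
      (hdisj p hp), Finset.sum_sub_distrib,
    sum_offDiag_setIntegral_cell hδ ht hD (h.integrableOn D D hD hb)]
  linarith [h.sum_offDiag_integral_mul_le hD hb hδ ht]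

/-- Off-diagonal cells see only disjoint sets, and the diagonal ones see at most one point each as
the mesh tends to zero; Fatou's lemma turns this into a bound without ever controlling `E #_D²`
beforehand. -/
lemma integrable_sq_and_integral_sq_le (h : HasClusterFunction P G) (hD : MeasurableSet D)
    (hb : Bornology.IsBounded D) :
    Integrable (fun X => (count D X : ℝ) ^ 2) P ∧
      ∫ X, (count D X : ℝ) ^ 2 ∂P ≤
        (∫ X, (count D X : ℝ) ∂P) + (∫ X, (count D X : ℝ) ∂P) ^ 2 - ∫ z in D ×ˢ D, G z := by
  have hfloor (δ : ℝ) : ∃ t : Finset ℤ, 0 < δ → ∀ y ∈ D, ⌊y / δ⌋ ∈ t := by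
    by_cases hδ : 0 < δ
    · exact (exists_finset_floor_div_mem hb hδ).imp fun t ht _ => ht
    · exact ⟨∅, fun h => (hδ h).elim⟩
  choose t ht using hfloor
  have hcount (j : ℤ) (δ : ℝ) : Measurable fun X => (count (D ∩ cell δ j) X : ℝ) :=
    measurable_natCast_count (hD.inter (measurableSet_cell δ j)) (hb.subset Set.inter_subset_left)
  refine integrable_and_integral_le_of_tendsto (l := 𝓝[>] 0)
    (u := fun δ X => (count D X : ℝ) +
      ∑ p ∈ (t δ).offDiag, (count (D ∩ cell δ p.1) X : ℝ) * count (D ∩ cell δ p.2) X)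
    ((measurable_natCast_count hD hb).pow_const 2).aestronglyMeasurable (fun X => by positivity)
    (fun δ => ((measurable_natCast_count hD hb).add (Finset.measurable_fun_sum _ fun p _ =>
      (hcount p.1 δ).mul (hcount p.2 δ))).aemeasurable)
    (fun δ X => by positivity) ?_
    (fun X => tendsto_const_nhds.congr' ((eventually_count_add_sum_offDiag_eq_sq X hb ht).mono
      fun _ => Eq.symm))
    (tendsto_const_nhds.sub (tendsto_setIntegral_floor_div_ne (h.integrableOn D D hD hb)))
  filter_upwards [self_mem_nhdsWithin] with δ hδ
  exact h.integral_count_add_sum_offDiag_le hD hb hδ (ht δ hδ)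

end HasClusterFunction

section Covariance

open ProbabilityTheory

variable {P : Measure Conf} {G : ℝ × ℝ → ℝ} {D D' : Set ℝ}

namespace HasClusterFunction

lemma memLp_count (h : HasClusterFunction P G) (hD : MeasurableSet D)
    (hb : Bornology.IsBounded D) : MemLp (fun X => (count D X : ℝ)) 2 P :=
  (memLp_two_iff_integrable_sq (measurable_natCast_count hD hb).aestronglyMeasurable).2
    (h.integrable_sq_and_integral_sq_le hD hb).1

lemma covariance_count [IsProbabilityMeasure P] (h : HasClusterFunction P G)
    (hD : MeasurableSet D) (hb : Bornology.IsBounded D) (hD' : MeasurableSet D')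
    (hb' : Bornology.IsBounded D') (hdisj : Disjoint D D') :
    cov[fun X => (count D X : ℝ), fun X => (count D' X : ℝ); P] = -∫ z in D ×ˢ D', G z := by
  rw [covariance_eq_sub (h.memLp_count hD hb) (h.memLp_count hD' hb')]
  simp only [Pi.mul_apply, h.integral_mul D D' hD hb hD' hb' hdisj]
  ring

lemma variance_count_le [IsProbabilityMeasure P] (h : HasClusterFunction P G)
    (hD : MeasurableSet D) (hb : Bornology.IsBounded D) :
    Var[fun X => (count D X : ℝ); P] ≤ (∫ X, (count D X : ℝ) ∂P) - ∫ z in D ×ˢ D, G z := by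
  rw [variance_eq_sub (h.memLp_count hD hb)]
  simp only [Pi.pow_apply]
  linarith [(h.integrable_sq_and_integral_sq_le hD hb).2]

end HasClusterFunction

/-- The signed count `#(X ∩ D ∩ ℝ₊) - #(X ∩ D ∩ ℝ₋)`, as a real number. -/
noncomputable def signedCount (D : Set ℝ) (X : Conf) : ℝ :=
  (count (D ∩ Set.Ioi 0) X : ℝ) - count (D ∩ Set.Iio 0) X

lemma measurable_signedCount (hD : MeasurableSet D) (hb : Bornology.IsBounded D) :
    Measurable (signedCount D) :=
  (measurable_natCast_count (hD.inter measurableSet_Ioi) (hb.subset Set.inter_subset_left)).sub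
    (measurable_natCast_count (hD.inter measurableSet_Iio) (hb.subset Set.inter_subset_left))

variable {K : ℝ → ℝ → ℂ} {T : L2 →L[ℂ] L2}

lemma setIntegral_signedSq_Ioi_Ioi (hD : MeasurableSet D) (hD' : MeasurableSet D') :
    ∫ z in (D ∩ Set.Ioi 0) ×ˢ (D' ∩ Set.Ioi 0), signedSq K z =
      energy K (D ∩ Set.Ioi 0) (D' ∩ Set.Ioi 0) := by
  rw [setIntegral_signedSq (hD.inter measurableSet_Ioi) (hD'.inter measurableSet_Ioi)
    (fun _ hx => Real.sign_of_pos hx.2) (fun _ hx => Real.sign_of_pos hx.2)]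
  ring

lemma setIntegral_signedSq_Ioi_Iio (hD : MeasurableSet D) (hD' : MeasurableSet D') :
    ∫ z in (D ∩ Set.Ioi 0) ×ˢ (D' ∩ Set.Iio 0), signedSq K z =
      -energy K (D ∩ Set.Ioi 0) (D' ∩ Set.Iio 0) := by
  rw [setIntegral_signedSq (hD.inter measurableSet_Ioi) (hD'.inter measurableSet_Iio)
    (fun _ hx => Real.sign_of_pos hx.2) (fun _ hx => Real.sign_of_neg hx.2)]
  ring

lemma setIntegral_signedSq_Iio_Ioi (hD : MeasurableSet D) (hD' : MeasurableSet D') :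
    ∫ z in (D ∩ Set.Iio 0) ×ˢ (D' ∩ Set.Ioi 0), signedSq K z =
      -energy K (D ∩ Set.Iio 0) (D' ∩ Set.Ioi 0) := by
  rw [setIntegral_signedSq (hD.inter measurableSet_Iio) (hD'.inter measurableSet_Ioi)
    (fun _ hx => Real.sign_of_neg hx.2) (fun _ hx => Real.sign_of_pos hx.2)]
  ring

lemma setIntegral_signedSq_Iio_Iio (hD : MeasurableSet D) (hD' : MeasurableSet D') :
    ∫ z in (D ∩ Set.Iio 0) ×ˢ (D' ∩ Set.Iio 0), signedSq K z =
      energy K (D ∩ Set.Iio 0) (D' ∩ Set.Iio 0) := by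
  rw [setIntegral_signedSq (hD.inter measurableSet_Iio) (hD'.inter measurableSet_Iio)
    (fun _ hx => Real.sign_of_neg hx.2) (fun _ hx => Real.sign_of_neg hx.2)]
  ring

namespace HasClusterFunction

lemma memLp_signedCount (h : HasClusterFunction P G) (hD : MeasurableSet D)
    (hb : Bornology.IsBounded D) : MemLp (signedCount D) 2 P :=
  (h.memLp_count (hD.inter measurableSet_Ioi) (hb.subset Set.inter_subset_left)).sub
    (h.memLp_count (hD.inter measurableSet_Iio) (hb.subset Set.inter_subset_left))

lemma covariance_signedCount [IsProbabilityMeasure P] (h : HasClusterFunction P (signedSq K))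
    (hint : IntegrableOn (fun z : ℝ × ℝ => ‖K z.1 z.2‖ ^ 2) (D ×ˢ D')) (hD : MeasurableSet D)
    (hb : Bornology.IsBounded D) (hD' : MeasurableSet D') (hb' : Bornology.IsBounded D')
    (hdisj : Disjoint D D') :
    cov[signedCount D, signedCount D'; P] = -energy K D D' := by
  have hp := hD.inter (measurableSet_Ioi (a := (0 : ℝ)))
  have hm := hD.inter (measurableSet_Iio (a := (0 : ℝ)))
  have hp' := hD'.inter (measurableSet_Ioi (a := (0 : ℝ)))
  have hm' := hD'.inter (measurableSet_Iio (a := (0 : ℝ)))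
  have hbs {E : Set ℝ} := hb.subset (Set.inter_subset_left (t := E))
  have hbs' {E : Set ℝ} := hb'.subset (Set.inter_subset_left (t := E))
  have hds {E E' : Set ℝ} : Disjoint (D ∩ E) (D' ∩ E') :=
    hdisj.mono Set.inter_subset_left Set.inter_subset_left
  unfold signedCount
  rw [covariance_fun_sub_fun_sub (h.memLp_count hp hbs) (h.memLp_count hm hbs)
      (h.memLp_count hp' hbs') (h.memLp_count hm' hbs'),
    h.covariance_count hp hbs hp' hbs' hds, h.covariance_count hp hbs hm' hbs' hds,
    h.covariance_count hm hbs hp' hbs' hds, h.covariance_count hm hbs hm' hbs' hds,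
    setIntegral_signedSq_Ioi_Ioi hD hD', setIntegral_signedSq_Ioi_Iio hD hD',
    setIntegral_signedSq_Iio_Ioi hD hD', setIntegral_signedSq_Iio_Iio hD hD',
    energy_eq_add_quadrants hD hD' hint]
  ring

lemma variance_signedCount_le [IsProbabilityMeasure P] (h : HasClusterFunction P (signedSq K))
    (hK : IsJHermitianKernel K T)
    (hint : IntegrableOn (fun z : ℝ × ℝ => ‖K z.1 z.2‖ ^ 2) (D ×ˢ D)) (hD : MeasurableSet D)
    (hb : Bornology.IsBounded D) :
    Var[signedCount D; P] ≤ (∫ X, (count (D ∩ Set.Ioi 0) X : ℝ) ∂P) +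
      (∫ X, (count (D ∩ Set.Iio 0) X : ℝ) ∂P) - energy K D D := by
  have hp := hD.inter (measurableSet_Ioi (a := (0 : ℝ)))
  have hm := hD.inter (measurableSet_Iio (a := (0 : ℝ)))
  have hbs {E : Set ℝ} := hb.subset (Set.inter_subset_left (t := E))
  have hdisj : Disjoint (D ∩ Set.Ioi 0) (D ∩ Set.Iio 0) :=
    Set.Ioi_disjoint_Iio_same.mono Set.inter_subset_right Set.inter_subset_right
  have hvarp := h.variance_count_le hp hbs
  have hvarm := h.variance_count_le hm hbs
  rw [setIntegral_signedSq_Ioi_Ioi hD hD] at hvarp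
  rw [setIntegral_signedSq_Iio_Iio hD hD] at hvarm
  unfold signedCount
  rw [variance_fun_sub (h.memLp_count hp hbs) (h.memLp_count hm hbs),
    h.covariance_count hp hbs hm hbs hdisj, setIntegral_signedSq_Ioi_Iio hD hD,
    energy_eq_add_quadrants hD hD hint]
  linarith [hK.energy_comm (D ∩ Set.Iio 0) (D ∩ Set.Ioi 0)]

end HasClusterFunction

end Covariance

section Determinantal

variable {P : Measure Conf} {K : ℝ → ℝ → ℂ} {T : L2 →L[ℂ] L2} {D D' : Set ℝ}

lemma IsDeterminantal.integrable_count (hP : IsDeterminantal K P) (hD : MeasurableSet D)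
    (hb : Bornology.IsBounded D) : Integrable (fun X => (count D X : ℝ)) P := by
  simpa using (hP.correlation 1 le_rfl (fun _ => D) (fun _ => hD) (fun _ => hb)
    Subsingleton.pairwise).1

lemma IsDeterminantal.integral_count (hP : IsDeterminantal K P) (hD : MeasurableSet D)
    (hb : Bornology.IsBounded D) :
    ((∫ X, (count D X : ℝ) ∂P : ℝ) : ℂ) = ∫ x in D, K x x := by
  have hcorr := (hP.correlation 1 le_rfl (fun _ => D) (fun _ => hD) (fun _ => hb)
    Subsingleton.pairwise).2.2
  simp only [Fin.prod_univ_one, Matrix.det_fin_one, Matrix.of_apply] at hcorr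
  have hpre : MeasurableEquiv.funUnique (Fin 1) ℝ ⁻¹' D = Set.univ.pi fun _ => D := by
    ext x
    simp
  rw [hcorr, ← (volume_preserving_funUnique (Fin 1) ℝ).setIntegral_preimage_emb
    (MeasurableEquiv.measurableEmbedding _) (fun x => K x x) D, hpre]
  rfl

lemma IsDeterminantal.integral_count_mul (hP : IsDeterminantal K P) (hD : MeasurableSet D)
    (hb : Bornology.IsBounded D) (hD' : MeasurableSet D') (hb' : Bornology.IsBounded D')
    (hdisj : Disjoint D D') :
    Integrable (fun X => (count D X : ℝ) * count D' X) P ∧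
      ((∫ X, (count D X : ℝ) * count D' X ∂P : ℝ) : ℂ) =
        ∫ z in D ×ˢ D', (K z.1 z.1 * K z.2 z.2 - K z.1 z.2 * K z.2 z.1) := by
  have hpair : Pairwise fun i j => Disjoint (![D, D'] i) (![D, D'] j) := by
    simpa [Pairwise, Fin.forall_fin_two] using ⟨hdisj, hdisj.symm⟩
  obtain ⟨hint, -, hcorr⟩ := hP.correlation 2 one_le_two ![D, D']
    (by simp [Fin.forall_fin_two, hD, hD']) (by simp [Fin.forall_fin_two, hb, hb']) hpair
  simp only [Fin.prod_univ_two, Matrix.det_fin_two, Matrix.of_apply, Matrix.cons_val_zero,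
    Matrix.cons_val_one] at hint hcorr
  have hpre : MeasurableEquiv.finTwoArrow (α := ℝ) ⁻¹' (D ×ˢ D') = Set.univ.pi ![D, D'] := by
    ext x
    simp [Fin.forall_fin_two]
  refine ⟨hint, hcorr.trans ?_⟩
  rw [← (volume_preserving_finTwoArrow ℝ).setIntegral_preimage_emb
    (MeasurableEquiv.measurableEmbedding _), hpre]
  rfl

lemma IsTraceDiagonal.setIntegral_det (hdiag : IsTraceDiagonal K T)
    (hK : IsJHermitianKernel K T) (hT : IsStarProjection (hat T)) (hD : MeasurableSet D)
    (hb : Bornology.IsBounded D) (hD' : MeasurableSet D') (hb' : Bornology.IsBounded D') :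
    ∫ z in D ×ˢ D', (K z.1 z.1 * K z.2 z.2 - K z.1 z.2 * K z.2 z.1) =
      (∫ x in D, K x x) * (∫ x in D', K x x) - ((∫ z in D ×ˢ D', signedSq K z : ℝ) : ℂ) := by
  have hprod : IntegrableOn (fun z : ℝ × ℝ => K z.1 z.1 * K z.2 z.2) (D ×ˢ D') := by
    rw [IntegrableOn, Measure.volume_eq_prod, ← Measure.prod_restrict]
    exact (hdiag.integrableOn hD hb).mul_prod (hdiag.integrableOn hD' hb')
  have hsgn : IntegrableOn (fun z => (signedSq K z : ℂ)) (D ×ˢ D') :=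
    (hdiag.integrableOn_signedSq hK.toIsIntegralKernel hT D hD' hb').ofReal
  calc ∫ z in D ×ˢ D', (K z.1 z.1 * K z.2 z.2 - K z.1 z.2 * K z.2 z.1)
      = ∫ z in D ×ˢ D', (K z.1 z.1 * K z.2 z.2 - (signedSq K z : ℂ)) := by
        refine integral_congr_ae (ae_restrict_of_ae ?_)
        filter_upwards [ae_ne_zero_prod] with z hz
        rw [hK.mul_swap hz.1 hz.2]
    _ = _ := by
        rw [integral_sub hprod hsgn, integral_complex_ofReal, Measure.volume_eq_prod,
          setIntegral_prod_mul (fun x => K x x) (fun y => K y y)]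

lemma IsDeterminantal.hasClusterFunction (hP : IsDeterminantal K P)
    (hK : IsJHermitianKernel K T) (hdiag : IsTraceDiagonal K T)
    (hT : IsStarProjection (hat T)) : HasClusterFunction P (signedSq K) where
  integrableOn D _ hD' hb' := hdiag.integrableOn_signedSq hK.toIsIntegralKernel hT D hD' hb'
  integrable_count _ := hP.integrable_count
  integrable_mul _ _ hD hb hD' hb' hdisj := (hP.integral_count_mul hD hb hD' hb' hdisj).1
  integral_mul D D' hD hb hD' hb' hdisj := by
    have hmul := (hP.integral_count_mul hD hb hD' hb' hdisj).2
    rw [hdiag.setIntegral_det hK hT hD hb hD' hb', ← hP.integral_count hD hb,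
      ← hP.integral_count hD' hb'] at hmul
    exact_mod_cast hmul

lemma IsDeterminantal.integral_count_Ioi_add_Iio (hP : IsDeterminantal K P)
    (hdiag : IsTraceDiagonal K T) (hD : MeasurableSet D) (hb : Bornology.IsBounded D) :
    (∫ X, (count (D ∩ Set.Ioi 0) X : ℝ) ∂P) + (∫ X, (count (D ∩ Set.Iio 0) X : ℝ) ∂P) =
      (∫ x in D, K x x).re := by
  have hp := hD.inter (measurableSet_Ioi (a := (0 : ℝ)))
  have hm := hD.inter (measurableSet_Iio (a := (0 : ℝ)))
  have hbs {E : Set ℝ} := hb.subset (Set.inter_subset_left (t := E))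
  rw [restrict_eq_restrict_Ioi_add_restrict_Iio hD, integral_add_measure
    (hdiag.integrableOn hp hbs) (hdiag.integrableOn hm hbs), ← hP.integral_count hp hbs,
    ← hP.integral_count hm hbs, Complex.add_re, Complex.ofReal_re, Complex.ofReal_re]

end Determinantal

/-! ### Dirichlet forms of summable conductances -/

/-- Banach–Saks averaging: each new vector is chosen almost orthogonal to the average of the
previous ones. -/
lemma exists_mem_mul_le_of_eventually_le {V α : Type*} [AddCommGroup V] [Module ℝ V]
    {Q : LinearMap.BilinForm ℝ V} (hQ : Q.IsSymm) {S : Set V} (hS : Convex ℝ S) {l : Filter α}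
    [l.NeBot] {g : α → V} (hg : ∀ᶠ a in l, g a ∈ S) {C : ℝ} (hC : ∀ᶠ a in l, Q (g a) (g a) ≤ C)
    (hlim : ∀ h, Tendsto (fun a => Q h (g a)) l (𝓝 0)) (n : ℕ) :
    ∃ h ∈ S, (n + 1) * Q h h ≤ C + 1 := by
  induction n with
  | zero =>
    obtain ⟨a, hCa, haS⟩ := (hC.and hg).exists
    exact ⟨g a, haS, by norm_num; linarith⟩
  | succ n ih =>
    obtain ⟨h, hhS, hh⟩ := ih
    obtain ⟨a, haS, hCa, hha⟩ := (hg.and (hC.and ((hlim h).eventually_le_const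
      (show (0 : ℝ) < 1 / (2 * (n + 1)) by positivity)))).exists
    rw [le_div_iff₀ (by positivity)] at hha
    refine ⟨((n + 1 : ℝ) / (n + 2)) • h + (1 / (n + 2) : ℝ) • g a,
      hS hhS haS (by positivity) (by positivity) (by field_simp; ring), ?_⟩
    calc ((n + 1 : ℕ) + 1 : ℝ) * Q (((n + 1 : ℝ) / (n + 2)) • h + (1 / (n + 2) : ℝ) • g a)
          (((n + 1 : ℝ) / (n + 2)) • h + (1 / (n + 2) : ℝ) • g a)
        = ((n + 1) * ((n + 1) * Q h h) + Q h (g a) * (2 * (n + 1)) + Q (g a) (g a)) / (n + 2) := by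
          simp only [map_add, map_smul, LinearMap.add_apply, LinearMap.smul_apply, smul_eq_mul,
            hQ.eq (g a) h]
          push_cast
          field_simp
          ring
      _ ≤ ((n + 1) * (C + 1) + 1 + C) / (n + 2) := by gcongr
      _ = C + 1 := by field_simp; ring

lemma exists_mem_le_of_eventually_le {V α : Type*} [AddCommGroup V] [Module ℝ V]
    {Q : LinearMap.BilinForm ℝ V} (hQ : Q.IsSymm) {S : Set V} (hS : Convex ℝ S) {l : Filter α}
    [l.NeBot] {g : α → V} (hg : ∀ᶠ a in l, g a ∈ S) {C : ℝ} (hC : ∀ᶠ a in l, Q (g a) (g a) ≤ C)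
    (hlim : ∀ h, Tendsto (fun a => Q h (g a)) l (𝓝 0)) {ε : ℝ} (hε : 0 < ε) :
    ∃ h ∈ S, Q h h ≤ ε := by
  obtain ⟨n, hn⟩ := exists_nat_ge ((C + 1) / ε)
  obtain ⟨h, hhS, hh⟩ := exists_mem_mul_le_of_eventually_le hQ hS hg hC hlim n
  rw [div_le_iff₀ hε] at hn
  exact ⟨h, hhS, le_of_mul_le_mul_left (show (n + 1 : ℝ) * Q h h ≤ (n + 1) * ε by linarith)
    (by positivity)⟩

section DirichletForm

variable {ι : Type*} {A : ι → ι → ℝ} {r : ι → ℝ}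

/-- The form `∑ᵢ rᵢ hᵢ gᵢ - ∑ᵢⱼ hᵢ gⱼ Aᵢⱼ` of the graph Laplacian with conductances `A`, on
finitely supported functions. It is the Dirichlet form of `A` when `rᵢ` is the total conductance
`∑ⱼ Aᵢⱼ` at `i`. -/
noncomputable def dirichletForm (A : ι → ι → ℝ) (r : ι → ℝ) : LinearMap.BilinForm ℝ (ι →₀ ℝ) :=
  Finsupp.linearCombination ℝ fun i => r i • Finsupp.lapply i - Finsupp.linearCombination ℝ (A i)

lemma dirichletForm_apply (h g : ι →₀ ℝ) : dirichletForm A r h g =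
    ∑ i ∈ h.support, h i * (r i * g i - ∑ j ∈ g.support, g j * A i j) := by
  simp [dirichletForm, Finsupp.linearCombination_apply, Finsupp.sum, LinearMap.sum_apply]

lemma dirichletForm_isSymm (hA : ∀ i j, A i j = A j i) : (dirichletForm A r).IsSymm := by
  refine ⟨fun h g => ?_⟩
  classical
  have diagonal (h g : ι →₀ ℝ) : ∑ i ∈ h.support, h i * (r i * g i) =
      ∑ i ∈ h.support ∪ g.support, h i * (r i * g i) :=
    Finset.sum_subset Finset.subset_union_left fun i _ hi => by
      simp [Finsupp.notMem_support_iff.1 hi]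
  simp only [dirichletForm_apply, mul_sub, Finset.sum_sub_distrib, diagonal, Finset.mul_sum]
  rw [Finset.sum_comm, Finset.union_comm]
  congr 1
  · exact Finset.sum_congr rfl fun i _ => by ring
  · exact Finset.sum_congr rfl fun i _ => Finset.sum_congr rfl fun j _ => by rw [hA]; ring

lemma tendsto_dirichletForm_zero {α : Type*} {l : Filter α} (hA : ∀ i j, 0 ≤ A i j)
    (hr : ∀ i, HasSum (A i) (r i)) {g : α → ι →₀ ℝ} (hg : ∀ a i, |g a i| ≤ 1)
    (hone : ∀ i, Tendsto (fun a => g a i) l (𝓝 1)) (h : ι →₀ ℝ) :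
    Tendsto (fun a => dirichletForm A r h (g a)) l (𝓝 0) := by
  have row (i : ι) :
      Tendsto (fun a => ∑ j ∈ (g a).support, g a j * A i j) l (𝓝 (r i)) := by
    have hsum (a : α) : ∑' j, g a j * A i j = ∑ j ∈ (g a).support, g a j * A i j :=
      tsum_eq_sum fun j hj => by simp [Finsupp.notMem_support_iff.1 hj]
    simp only [← hsum]
    rw [← (hr i).tsum_eq, ← tsum_congr fun j => one_mul (A i j)]
    refine tendsto_tsum_of_dominated_convergence (bound := A i) (hr i).summable
      (fun j => (hone j).mul_const _) (Eventually.of_forall fun a j => ?_)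
    rw [Real.norm_eq_abs, abs_mul, abs_of_nonneg (hA i j)]
    exact mul_le_of_le_one_left (hA i j) (hg a j)
  simp only [dirichletForm_apply]
  rw [← Finset.sum_const_zero (s := h.support)]
  refine tendsto_finsetSum _ fun i _ => ?_
  simpa using (((hone i).const_mul (r i)).sub (row i)).const_mul (h i)

lemma hasSum_mul_fst (hr : ∀ i, HasSum (A i) (r i)) {f : ι → ℝ} {s : Finset ι}
    (hf : ∀ i ∉ s, f i = 0) :
    HasSum (fun p : ι × ι => f p.1 * A p.1 p.2) (∑ i ∈ s, f i * r i) := by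
  classical
  have single (i : ι) : HasSum (fun p : ι × ι => if p.1 = i then f i * A i p.2 else 0)
      (f i * r i) := by
    rw [← (Prod.mk_right_injective i).hasSum_iff]
    · simpa [Function.comp_def] using (hr i).mul_left (f i)
    · rintro ⟨a, b⟩ hab
      exact if_neg fun h => hab ⟨b, by simp [← h]⟩
  refine (hasSum_sum fun i (_ : i ∈ s) => single i).congr_fun fun p => ?_
  rw [Finset.sum_ite_eq]
  split_ifs with h
  · rfl
  · simp [hf _ h]

lemma hasSum_dirichletForm (hA : ∀ i j, A i j = A j i) (hr : ∀ i, HasSum (A i) (r i))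
    (g : ι →₀ ℝ) :
    HasSum (fun p : ι × ι => (g p.1 - g p.2) ^ 2 * A p.1 p.2) (2 * dirichletForm A r g g) := by
  have hfst : HasSum (fun p : ι × ι => g p.1 ^ 2 * A p.1 p.2) (∑ i ∈ g.support, g i ^ 2 * r i) :=
    hasSum_mul_fst hr (f := fun i => g i ^ 2) fun i hi => by
      simp [Finsupp.notMem_support_iff.1 hi]
  have hsnd : HasSum (fun p : ι × ι => g p.2 ^ 2 * A p.1 p.2)
      (∑ i ∈ g.support, g i ^ 2 * r i) :=
    ((Equiv.prodComm ι ι).hasSum_iff.2 hfst).congr_fun fun p => by simp [hA p.1 p.2]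
  have hcross : HasSum (fun p : ι × ι => g p.1 * g p.2 * A p.1 p.2)
      (∑ p ∈ g.support ×ˢ g.support, g p.1 * g p.2 * A p.1 p.2) := by
    refine hasSum_sum_of_ne_finset_zero fun p hp => ?_
    rw [Finset.mem_product, not_and_or] at hp
    rcases hp with hp | hp <;> simp [Finsupp.notMem_support_iff.1 hp]
  have hform : dirichletForm A r g g = ∑ i ∈ g.support, g i ^ 2 * r i -
      ∑ p ∈ g.support ×ˢ g.support, g p.1 * g p.2 * A p.1 p.2 := by
    rw [dirichletForm_apply, Finset.sum_product, ← Finset.sum_sub_distrib]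
    refine Finset.sum_congr rfl fun i _ => ?_
    rw [mul_sub, Finset.mul_sum]
    congr 1
    · ring
    · exact Finset.sum_congr rfl fun j _ => by ring
  have := (hfst.add hsnd).sub (hcross.mul_left 2)
  rw [hform, mul_sub, two_mul (∑ i ∈ g.support, g i ^ 2 * r i)]
  exact this.congr_fun fun p => by ring

lemma two_mul_ofReal_dirichletForm (hA : ∀ i j, 0 ≤ A i j) (hsymm : ∀ i j, A i j = A j i)
    (hr : ∀ i, HasSum (A i) (r i)) (g : ι →₀ ℝ) :
    2 * ENNReal.ofReal (dirichletForm A r g g) =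
      ∑' i, ∑' j, ENNReal.ofReal ((g i - g j) ^ 2 * A i j) := by
  have hsum := hasSum_dirichletForm hsymm hr g
  rw [← ENNReal.tsum_prod (f := fun i j => ENNReal.ofReal ((g i - g j) ^ 2 * A i j)),
    ← ENNReal.ofReal_tsum_of_nonneg (fun p => mul_nonneg (sq_nonneg _) (hA _ _)) hsum.summable,
    hsum.tsum_eq, ENNReal.ofReal_mul zero_le_two, ENNReal.ofReal_ofNat]

/-- Each pair `(i, j)` with `w i j ≠ 0` is charged to whichever of `i` and `j` lies in `F` or, if
neither does, to whichever lies in `W`. -/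
lemma tsum_tsum_le_two_mul_of_symm [DecidableEq ι] {w : ι → ι → ℝ≥0∞}
    (hsymm : ∀ i j, w i j = w j i) {W : Finset ι} (hW : ∀ i ∉ W, ∀ j ∉ W, w i j = 0)
    (F : Finset ι) :
    ∑' i, ∑' j, w i j ≤
      2 * (∑ i ∈ F, ∑' j, w i j + ∑ i ∈ W \ F, ∑' j : ((F : Set ι)ᶜ : Set ι), w i j) := by
  let v (i j : ι) : ℝ≥0∞ :=
    (if i ∈ F then w i j else 0) + if i ∈ W \ F then (F : Set ι)ᶜ.indicator (w i) j else 0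
  have hwv (i j : ι) : w i j ≤ v i j + v j i := by
    by_cases hi : i ∈ F
    · exact le_add_right (le_add_right (by simp [hi]))
    by_cases hj : j ∈ F
    · exact le_add_left (le_add_right (by simp [hj, hsymm i j]))
    by_cases hiW : i ∈ W
    · exact le_add_right (le_add_left (by simp [hi, hj, hiW]))
    by_cases hjW : j ∈ W
    · exact le_add_left (le_add_left (by simp [hi, hj, hjW, hsymm i j]))
    simp [hW i hiW j hjW]
  calc ∑' i, ∑' j, w i j
      ≤ ∑' i, ∑' j, (v i j + v j i) :=
        ENNReal.tsum_le_tsum fun i => ENNReal.tsum_le_tsum fun j => hwv i j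
    _ = 2 * ∑' i, ∑' j, v i j := by
        simp only [ENNReal.tsum_add]
        rw [ENNReal.tsum_comm (f := fun i j => v j i), two_mul]
    _ = _ := by
        simp only [v, ENNReal.tsum_add]
        rw [tsum_eq_sum (s := F) fun i hi => by simp [hi],
          tsum_eq_sum (s := W \ F) fun i hi => by simp [hi]]
        congr 2 <;> exact Finset.sum_congr rfl fun i hi => by simp only [hi, if_true, tsum_subtype]

lemma ofReal_dirichletForm_le [DecidableEq ι] (hA : ∀ i j, 0 ≤ A i j) (hsymm : ∀ i j, A i j = A j i)
    (hr : ∀ i, HasSum (A i) (r i)) {g : ι →₀ ℝ} (hg : ∀ i, g i ∈ Set.Icc 0 1) {W : Finset ι}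
    (hW : g.support ⊆ W) (F : Finset ι) :
    ENNReal.ofReal (dirichletForm A r g g) ≤ ∑ i ∈ F, ENNReal.ofReal (r i) +
      ∑ i ∈ W \ F, ∑' j : ((F : Set ι)ᶜ : Set ι),
        ENNReal.ofReal ((g i - g j) ^ 2 * A i j) := by
  have hle (i j : ι) : (g i - g j) ^ 2 * A i j ≤ A i j := by
    obtain ⟨hi, hi'⟩ := hg i
    obtain ⟨hj, hj'⟩ := hg j
    exact mul_le_of_le_one_left (hA i j)
      ((sq_le_one_iff_abs_le_one _).2 (abs_le.2 ⟨by linarith, by linarith⟩))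
  have hrow (i : ι) : ∑' j, ENNReal.ofReal ((g i - g j) ^ 2 * A i j) ≤ ENNReal.ofReal (r i) := by
    rw [← (hr i).tsum_eq, ENNReal.ofReal_tsum_of_nonneg (hA i) (hr i).summable]
    exact ENNReal.tsum_le_tsum fun j => ENNReal.ofReal_le_ofReal (hle i j)
  have hzero (i : ι) (hi : i ∉ W) : g i = 0 := Finsupp.notMem_support_iff.1 fun h => hi (hW h)
  refine (ENNReal.mul_le_mul_iff_right two_ne_zero ENNReal.ofNat_ne_top).1 ?_
  rw [two_mul_ofReal_dirichletForm hA hsymm hr g]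
  refine (tsum_tsum_le_two_mul_of_symm (W := W) (fun i j => by rw [hsymm i j, sub_sq_comm])
    (fun i hi j hj => by simp [hzero i hi, hzero j hj]) F).trans ?_
  gcongr
  exact hrow _

end DirichletForm

/-- Summation by parts: `m² = ∑ (2k + 1)` over `k < m`. -/
lemma tsum_min_sq_mul_le {ι : Type*} {a : ι → ℝ≥0∞} {d : ι → ℕ} {C : ℝ≥0∞}
    (h : ∀ k : ℕ, (k + 1) * ∑' j : {j | k < d j}, a j ≤ C) (R : ℕ) :
    ∑' j, ((min R (d j) : ℕ) : ℝ≥0∞) ^ 2 * a j ≤ R * (2 * C) := by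
  have sq_eq_sum (m : ℕ) : (m : ℝ≥0∞) ^ 2 = ∑ k ∈ Finset.range m, ((2 * k + 1 : ℕ) : ℝ≥0∞) := by
    rw [← Nat.cast_sum, ← Nat.cast_pow, Finset.sum_add_distrib, ← Finset.mul_sum,
      mul_comm, Finset.sum_range_id_mul_two]
    congr 1
    cases m with
    | zero => simp
    | succ m => simp; ring
  have expand (j : ι) : ((min R (d j) : ℕ) : ℝ≥0∞) ^ 2 * a j =
      ∑ k ∈ Finset.range R, ((2 * k + 1 : ℕ) : ℝ≥0∞) * {j | k < d j}.indicator a j := by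
    have hrange : Finset.range (min R (d j)) = (Finset.range R).filter (· < d j) := by
      ext k; simp
    rw [sq_eq_sum, hrange, Finset.sum_filter, Finset.sum_mul]
    exact Finset.sum_congr rfl fun k _ => by by_cases hk : k < d j <;> simp [hk]
  calc ∑' j, ((min R (d j) : ℕ) : ℝ≥0∞) ^ 2 * a j
      = ∑ k ∈ Finset.range R, ((2 * k + 1 : ℕ) : ℝ≥0∞) * ∑' j : {j | k < d j}, a j := by
        simp only [expand, tsum_subtype]
        rw [Summable.tsum_finsetSum fun k _ => ENNReal.summable]
        simp only [ENNReal.tsum_mul_left]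
    _ ≤ ∑ _k ∈ Finset.range R, 2 * C := by
        refine Finset.sum_le_sum fun k _ => le_trans ?_ (mul_le_mul_right (h k) 2)
        rw [← mul_assoc]
        gcongr
        norm_cast
        omega
    _ = R * (2 * C) := by simp

/-- The trapezoidal cut-off at scale `R`: it is `1` on `[-R, R]`, `0` off `[-2R, 2R]`, and linear in
between. The subtraction is the truncated one. -/
noncomputable def cutoff (R : ℕ) : ℤ →₀ ℝ :=
  Finsupp.onFinset (Finset.Icc (-(2 * R) : ℤ) (2 * R))
    (fun i => ((min R (2 * R - i.natAbs) : ℕ) : ℝ) / R) fun i hi => by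
      contrapose! hi
      rw [show min R (2 * R - i.natAbs) = 0 by grind, Nat.cast_zero, zero_div]

lemma cutoff_apply (R : ℕ) (i : ℤ) :
    cutoff R i = ((min R (2 * R - i.natAbs) : ℕ) : ℝ) / R := rfl

lemma support_cutoff_subset (R : ℕ) :
    (cutoff R).support ⊆ Finset.Icc (-(2 * R) : ℤ) (2 * R) :=
  Finsupp.support_onFinset_subset

lemma cutoff_mem_Icc (R : ℕ) (i : ℤ) : cutoff R i ∈ Set.Icc 0 1 :=
  ⟨by rw [cutoff_apply]; positivity,
    div_le_one_of_le₀ (Nat.cast_le.2 (min_le_left _ _)) R.cast_nonneg⟩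

lemma eventually_cutoff_eq_one (i : ℤ) : ∀ᶠ R in atTop, cutoff R i = 1 := by
  filter_upwards [eventually_ge_atTop (i.natAbs + 1)] with R hR
  rw [cutoff_apply, show min R (2 * R - i.natAbs) = R by omega, div_self]
  exact Nat.cast_ne_zero.2 (by omega)

lemma abs_cutoff_sub_le (R : ℕ) (i j : ℤ) :
    |cutoff R i - cutoff R j| ≤ ((min R (i - j).natAbs : ℕ) : ℝ) / R := by
  rw [cutoff_apply, cutoff_apply, ← sub_div, abs_div, Nat.abs_cast]
  gcongr
  have : |((min R (2 * R - i.natAbs) : ℕ) : ℤ) - (min R (2 * R - j.natAbs) : ℕ)| ≤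
      (min R (i - j).natAbs : ℕ) := by
    rw [abs_le]; omega
  rw [← Int.cast_natCast, ← Int.cast_natCast (min R (2 * R - j.natAbs)), ← Int.cast_sub,
    ← Int.cast_abs, ← Int.cast_natCast (min R (i - j).natAbs)]
  exact Int.cast_le.2 this

lemma ofReal_cutoff_sub_sq_le {R : ℕ} (hR : R ≠ 0) (i j : ℤ) :
    ENNReal.ofReal ((cutoff R i - cutoff R j) ^ 2) ≤
      (R ^ 2 : ℝ≥0∞)⁻¹ * ((min R (i - j).natAbs : ℕ) : ℝ≥0∞) ^ 2 := by
  rw [← sq_abs, ENNReal.ofReal_pow (abs_nonneg _), ENNReal.inv_pow, ← mul_pow, mul_comm,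
    ← div_eq_mul_inv, ← ENNReal.ofReal_natCast R, ← ENNReal.ofReal_natCast,
    ← ENNReal.ofReal_div_of_pos (by positivity)]
  gcongr
  exact abs_cutoff_sub_le R i j

lemma sum_tsum_cutoff_sub_sq_le {A : ℤ → ℤ → ℝ} {S : Set ℤ} {C : ℝ≥0∞}
    (htail : ∀ i ∈ S, ∀ k : ℕ,
      (k + 1) * ∑' j : ({j | k < (i - j).natAbs} ∩ S : Set ℤ), ENNReal.ofReal (A i j) ≤ C)
    {R : ℕ} (hR : R ≠ 0) {i : ℤ} (hi : i ∈ S) :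
    ∑' j : S, ENNReal.ofReal ((cutoff R i - cutoff R j) ^ 2 * A i j) ≤ 2 * C / R := by
  have hterm (j : ℤ) : S.indicator
      (fun j => ENNReal.ofReal ((cutoff R i - cutoff R j) ^ 2 * A i j)) j ≤ (R ^ 2 : ℝ≥0∞)⁻¹ *
        (((min R (i - j).natAbs : ℕ) : ℝ≥0∞) ^ 2 *
          S.indicator (fun j => ENNReal.ofReal (A i j)) j) := by
    by_cases hj : j ∈ S
    · rw [Set.indicator_of_mem hj, Set.indicator_of_mem hj, ← mul_assoc,
        ENNReal.ofReal_mul (sq_nonneg _)]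
      gcongr
      exact ofReal_cutoff_sub_sq_le hR i j
    · simp [hj]
  rw [tsum_subtype S fun j => ENNReal.ofReal ((cutoff R i - cutoff R j) ^ 2 * A i j)]
  calc _ ≤ (R ^ 2 : ℝ≥0∞)⁻¹ * ∑' j, ((min R (i - j).natAbs : ℕ) : ℝ≥0∞) ^ 2 *
          S.indicator (fun j => ENNReal.ofReal (A i j)) j := by
        rw [← ENNReal.tsum_mul_left]
        exact ENNReal.tsum_le_tsum hterm
    _ ≤ (R ^ 2 : ℝ≥0∞)⁻¹ * (R * (2 * C)) := by
        gcongr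
        refine tsum_min_sq_mul_le (fun k => ?_) R
        rw [tsum_subtype, Set.indicator_indicator, ← tsum_subtype]
        exact htail i hi k
    _ = 2 * C / R := by
        have hR' : (R : ℝ≥0∞) ≠ 0 := Nat.cast_ne_zero.2 hR
        rw [sq, ENNReal.mul_inv (.inl hR') (.inr hR'), mul_assoc, ← mul_assoc _ (R : ℝ≥0∞),
          ENNReal.inv_mul_cancel hR' (ENNReal.natCast_ne_top R), one_mul, div_eq_mul_inv, mul_comm]

lemma ofReal_dirichletForm_cutoff_le {A : ℤ → ℤ → ℝ} {r : ℤ → ℝ} (hA : ∀ i j, 0 ≤ A i j)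
    (hsymm : ∀ i j, A i j = A j i) (hr : ∀ i, HasSum (A i) (r i)) (F : Finset ℤ) {C : ℝ≥0∞}
    (htail : ∀ i ∉ F, ∀ k : ℕ, (k + 1) *
      ∑' j : ({j | k < (i - j).natAbs} ∩ (F : Set ℤ)ᶜ : Set ℤ), ENNReal.ofReal (A i j) ≤ C)
    {R : ℕ} (hR : R ≠ 0) :
    ENNReal.ofReal (dirichletForm A r (cutoff R) (cutoff R)) ≤
      ∑ i ∈ F, ENNReal.ofReal (r i) + 10 * C := by
  set W := Finset.Icc (-(2 * R) : ℤ) (2 * R)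
  have hcard : ((W \ F).card : ℝ≥0∞) ≤ 5 * R := by
    have : W.card ≤ 5 * R := by rw [Int.card_Icc]; omega
    exact_mod_cast (Finset.card_le_card Finset.sdiff_subset).trans this
  refine (ofReal_dirichletForm_le hA hsymm hr (cutoff_mem_Icc R)
    (support_cutoff_subset R) F).trans ?_
  gcongr
  calc _ ≤ ∑ i ∈ W \ F, 2 * C / R := Finset.sum_le_sum fun i hi =>
        sum_tsum_cutoff_sub_sq_le htail hR (Finset.mem_sdiff.1 hi).2
    _ ≤ 5 * R * (2 * C / R) := by
        rw [Finset.sum_const, nsmul_eq_mul]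
        gcongr
    _ = 10 * C := by
        rw [mul_assoc, ENNReal.mul_div_cancel (by simpa) (by simp), ← mul_assoc]
        norm_num

/-- Almost harmonic cut-offs: a summable network on `ℤ` whose conductances have tails `O(1/k)` is
recurrent. -/
lemma exists_finsupp_dirichletForm_le {A : ℤ → ℤ → ℝ} {r : ℤ → ℝ} (hA : ∀ i j, 0 ≤ A i j)
    (hsymm : ∀ i j, A i j = A j i) (hr : ∀ i, HasSum (A i) (r i)) (F : Finset ℤ) {C : ℝ≥0∞}
    (hC : C ≠ ∞) (htail : ∀ i ∉ F, ∀ k : ℕ, (k + 1) *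
      ∑' j : ({j | k < (i - j).natAbs} ∩ (F : Set ℤ)ᶜ : Set ℤ), ENNReal.ofReal (A i j) ≤ C)
    (t : Finset ℤ) {ε : ℝ} (hε : 0 < ε) :
    ∃ h : ℤ →₀ ℝ, (∀ i ∈ t, h i = 1) ∧ dirichletForm A r h h ≤ ε := by
  have hfin : ∑ i ∈ F, ENNReal.ofReal (r i) + 10 * C ≠ ∞ := ENNReal.add_ne_top.2
    ⟨ENNReal.sum_ne_top.2 fun i _ => ENNReal.ofReal_ne_top, ENNReal.mul_ne_top (by norm_num) hC⟩
  refine exists_mem_le_of_eventually_le (S := {h | ∀ i ∈ t, h i = 1}) (l := atTop) (g := cutoff)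
    (C := (∑ i ∈ F, ENNReal.ofReal (r i) + 10 * C).toReal) (dirichletForm_isSymm hsymm)
    ?_ ?_ ?_ ?_ hε
  · intro h hh g hg a b _ _ hab i hi
    simp [hh i hi, hg i hi, hab]
  · exact (eventually_all_finset t).2 fun i _ => eventually_cutoff_eq_one i
  · filter_upwards [eventually_ne_atTop 0] with R hR
    exact (ENNReal.ofReal_le_iff_le_toReal hfin).1
      (ofReal_dirichletForm_cutoff_le hA hsymm hr F htail hR)
  · refine tendsto_dirichletForm_zero hA hr (fun R i => ?_) fun i =>
      tendsto_const_nhds.congr' ((eventually_cutoff_eq_one i).mono fun R hR => hR.symm)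
    exact abs_le.2 ⟨by linarith [(cutoff_mem_Icc R i).1], (cutoff_mem_Icc R i).2⟩

/-! ### Conductances between unit cells -/

section CellEnergy

variable {K : ℝ → ℝ → ℂ} {T : L2 →L[ℂ] L2} {D : Set ℝ} {ι : Type*} [Countable ι] {E : ι → Set ℝ}

lemma IsTraceDiagonal.hasSum_energy (hdiag : IsTraceDiagonal K T) (hK : IsJHermitianKernel K T)
    (hT : IsStarProjection (hat T)) (hD : MeasurableSet D) (hb : Bornology.IsBounded D)
    (hE : ∀ j, MeasurableSet (E j)) (hdisj : Pairwise (Function.onFun Disjoint E))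
    (huniv : ⋃ j, E j = Set.univ) :
    HasSum (fun j => energy K D (E j)) (∫ x in D, K x x).re := by
  have htotal : ∑' j, ENNReal.ofReal (energy K D (E j)) =
      ENNReal.ofReal (∫ x in D, K x x).re := by
    simp only [hK.energy_comm D, hdiag.ofReal_energy hK.toIsIntegralKernel hT _ hD hb]
    rw [← lintegral_iUnion hE hdisj, huniv, setLIntegral_univ,
      hdiag.lintegral_enorm_sq hK.toIsIntegralKernel hT hD hb]
  have := ENNReal.hasSum_toReal (htotal ▸ ENNReal.ofReal_ne_top)
  rw [← ENNReal.tsum_toReal_eq fun _ => ENNReal.ofReal_ne_top, htotal,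
    ENNReal.toReal_ofReal (hdiag.re_integral_nonneg hT hD hb)] at this
  simpa only [ENNReal.toReal_ofReal (energy_nonneg K D _)] using this

lemma IsTraceDiagonal.tsum_ofReal_energy (hdiag : IsTraceDiagonal K T) (hK : IsIntegralKernel K T)
    (hT : IsStarProjection (hat T)) (D : Set ℝ) (hE : ∀ j, MeasurableSet (E j))
    (hb : ∀ j, Bornology.IsBounded (E j)) (hdisj : Pairwise (Function.onFun Disjoint E)) :
    ∑' j, ENNReal.ofReal (energy K D (E j)) = ∫⁻ x in D, ∫⁻ y in ⋃ j, E j, ‖K x y‖ₑ ^ 2 := by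
  have hmeas : Measurable fun p : ℝ × ℝ => ‖K p.1 p.2‖ₑ ^ 2 := hK.measurable.enorm.pow_const 2
  simp only [hdiag.ofReal_energy hK hT D (hE _) (hb _), lintegral_iUnion hE hdisj]
  exact (lintegral_tsum fun j => hmeas.lintegral_prod_right'.aemeasurable).symm

lemma setLIntegral_enorm_sq_le {k : ℝ → ℂ} {Φ : ℝ → ℝ} {x s : ℝ} {E : Set ℝ} (hE : MeasurableSet E)
    (hs : ∀ y ∈ E, s ≤ |x - y|) (hΦ : ∀ y ∈ E, ‖k y‖ ^ 2 ≤ Φ (x - y)) :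
    ∫⁻ y in E, ‖k y‖ₑ ^ 2 ≤ ∫⁻ t in {t | s ≤ |t|}, ENNReal.ofReal (Φ t) := by
  rw [← lintegral_indicator hE,
    ← lintegral_indicator (measurableSet_le measurable_const continuous_abs.measurable),
    ← lintegral_sub_left_eq_self ({t | s ≤ |t|}.indicator fun t => ENNReal.ofReal (Φ t)) x]
  refine lintegral_mono fun y => Set.indicator_apply_le' (fun hy => ?_) fun _ => zero_le
  rw [Set.indicator_of_mem (show x - y ∈ {t | s ≤ |t|} from hs y hy), ← ofReal_norm,
    ← ENNReal.ofReal_pow (norm_nonneg _)]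
  exact ENNReal.ofReal_le_ofReal (hΦ y hy)

lemma exists_mul_setLIntegral_le {Φ : ℝ → ℝ} (h0 : ∀ t, 0 ≤ Φ t) (hi : Integrable Φ)
    (hO : (fun R : ℝ => ∫ t in {t | R ≤ |t|}, Φ t) =O[atTop] fun R => R⁻¹) :
    ∃ C : ℝ≥0∞, C ≠ ∞ ∧
      ∀ k : ℕ, (k + 1) * ∫⁻ t in {t | (k : ℝ) ≤ |t|}, ENNReal.ofReal (Φ t) ≤ C := by
  have hshift : (fun k : ℕ => (k : ℝ)⁻¹) =O[atTop] fun k => ((k : ℝ) + 1)⁻¹ := by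
    refine IsBigO.of_bound 2 ?_
    filter_upwards [eventually_ge_atTop 1] with k hk
    have : (1 : ℝ) ≤ k := Nat.one_le_cast.2 hk
    rw [norm_inv, norm_inv, Real.norm_of_nonneg (by positivity),
      Real.norm_of_nonneg (by positivity), ← div_eq_mul_inv, inv_eq_one_div,
      div_le_div_iff₀ (by positivity) (by positivity)]
    linarith
  obtain ⟨C, -, hC⟩ := bound_of_isBigO_nat_atTop
    ((hO.comp_tendsto tendsto_natCast_atTop_atTop).trans hshift)
  refine ⟨ENNReal.ofReal C, ENNReal.ofReal_ne_top, fun k => ?_⟩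
  have hk := hC (x := k) (by positivity)
  rw [Function.comp_apply, Real.norm_of_nonneg (integral_nonneg h0),
    Real.norm_of_nonneg (by positivity), ← div_eq_mul_inv, le_div_iff₀ (by positivity)] at hk
  rw [← ofReal_integral_eq_lintegral_ofReal hi.integrableOn (Eventually.of_forall h0),
    ← ENNReal.ofReal_natCast, ← ENNReal.ofReal_one,
    ← ENNReal.ofReal_add (by positivity) zero_le_one, ← ENNReal.ofReal_mul (by positivity),
    mul_comm]
  exact ENNReal.ofReal_le_ofReal hk

lemma natCast_le_abs_sub_of_mem_cell {i j : ℤ} {k : ℕ} (h : k < (i - j).natAbs) {x y : ℝ}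
    (hx : x ∈ cell 1 i) (hy : y ∈ cell 1 j) : (k : ℝ) ≤ |x - y| := by
  simp only [cell, mul_one, Set.mem_Ico] at hx hy
  rcases le_total j i with hji | hij
  · have : (k : ℝ) + 1 ≤ i - j := by exact_mod_cast (by omega : (k : ℤ) + 1 ≤ i - j)
    exact le_abs.2 (.inl (by linarith))
  · have : (k : ℝ) + 1 ≤ j - i := by exact_mod_cast (by omega : (k : ℤ) + 1 ≤ j - i)
    exact le_abs.2 (.inr (by linarith))

lemma exists_finset_forall_notMem_cell_le_abs (M : ℝ) :
    ∃ F : Finset ℤ, ∀ i ∉ F, ∀ x ∈ cell 1 i, M ≤ |x| := by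
  obtain ⟨F, hF⟩ := exists_finset_floor_div_mem (Metric.isBounded_Ioo (-M) M) one_pos
  refine ⟨F, fun i hi x hx => not_lt.1 fun h => hi ?_⟩
  rw [← (mem_cell_iff one_pos).1 hx]
  exact hF x (abs_lt.1 h)

lemma IsTraceDiagonal.exists_mul_tsum_energy_cell_le (hdiag : IsTraceDiagonal K T)
    (hK : IsIntegralKernel K T) (hT : IsStarProjection (hat T)) {Φ : ℝ → ℝ} (h0 : ∀ t, 0 ≤ Φ t)
    (hi : Integrable Φ) (hO : (fun R : ℝ => ∫ t in {t | R ≤ |t|}, Φ t) =O[atTop] fun R => R⁻¹)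
    {M : ℝ} (hΦ : ∀ x y : ℝ, M ≤ |x| → M ≤ |y| → ‖K x y‖ ^ 2 ≤ Φ (x - y)) :
    ∃ (F : Finset ℤ) (C : ℝ≥0∞), C ≠ ∞ ∧ ∀ i ∉ F, ∀ k : ℕ, (k + 1) *
      ∑' j : ({j | k < (i - j).natAbs} ∩ (F : Set ℤ)ᶜ : Set ℤ),
        ENNReal.ofReal (energy K (cell 1 i) (cell 1 j)) ≤ C := by
  obtain ⟨F, hF⟩ := exists_finset_forall_notMem_cell_le_abs M
  obtain ⟨C, hC, htail⟩ := exists_mul_setLIntegral_le h0 hi hO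
  refine ⟨F, C, hC, fun i hiF k => le_trans ?_ (htail k)⟩
  gcongr
  set S : Set ℤ := {j | k < (i - j).natAbs} ∩ (F : Set ℤ)ᶜ
  calc ∑' j : S, ENNReal.ofReal (energy K (cell 1 i) (cell 1 j))
      = ∫⁻ x in cell 1 i, ∫⁻ y in ⋃ j : S, cell 1 j, ‖K x y‖ₑ ^ 2 :=
        hdiag.tsum_ofReal_energy hK hT _ (fun j => measurableSet_cell 1 j)
          (fun j => isBounded_cell 1 j)
          ((pairwise_disjoint_cell one_pos).comp_of_injective Subtype.val_injective)
    _ ≤ ∫⁻ _ in cell 1 i, ∫⁻ t in {t | (k : ℝ) ≤ |t|}, ENNReal.ofReal (Φ t) := by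
        refine setLIntegral_mono measurable_const fun x hx => ?_
        refine setLIntegral_enorm_sq_le (x := x) (.iUnion fun j => measurableSet_cell 1 j)
          (fun y hy => ?_) (fun y hy => ?_) <;>
        obtain ⟨⟨j, hjk, hjF⟩, hy⟩ := Set.mem_iUnion.1 hy
        · exact natCast_le_abs_sub_of_mem_cell hjk hx hy
        · exact hΦ x y (hF i hiF x hx) (hF j hjF y hy)
    _ = ∫⁻ t in {t | (k : ℝ) ≤ |t|}, ENNReal.ofReal (Φ t) := by
        rw [setLIntegral_const, volume_cell, ENNReal.ofReal_one, mul_one]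

lemma IsTraceDiagonal.exists_finsupp_dirichletForm_energy_le
    (hdiag : IsTraceDiagonal K T) (hK : IsJHermitianKernel K T) (hT : IsStarProjection (hat T))
    {Φ : ℝ → ℝ} (h0 : ∀ t, 0 ≤ Φ t) (hi : Integrable Φ)
    (hO : (fun R : ℝ => ∫ t in {t | R ≤ |t|}, Φ t) =O[atTop] fun R => R⁻¹) {M : ℝ}
    (hΦ : ∀ x y : ℝ, M ≤ |x| → M ≤ |y| → ‖K x y‖ ^ 2 ≤ Φ (x - y)) (t : Finset ℤ) {ε : ℝ}
    (hε : 0 < ε) :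
    ∃ h : ℤ →₀ ℝ, (∀ i ∈ t, h i = 1) ∧
      dirichletForm (fun i j => energy K (cell 1 i) (cell 1 j))
        (fun i => (∫ x in cell 1 i, K x x).re) h h ≤ ε := by
  obtain ⟨F, C, hC, htail⟩ :=
    hdiag.exists_mul_tsum_energy_cell_le hK.toIsIntegralKernel hT h0 hi hO hΦ
  have hr (i : ℤ) := hdiag.hasSum_energy hK hT (measurableSet_cell 1 i) (isBounded_cell 1 i)
    (measurableSet_cell 1) (pairwise_disjoint_cell one_pos) (iUnion_cell one_pos)
  exact exists_finsupp_dirichletForm_le (fun i j => energy_nonneg K (cell 1 i) (cell 1 j))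
    (fun i j => hK.energy_comm (cell 1 i) (cell 1 j)) hr F hC htail t hε

end CellEnergy

/-! ### Rigidity from linear statistics of small variance -/

section Rigidity

open ProbabilityTheory

lemma exists_seq_tendsto_ae_sub_integral_of_tendsto_variance {α : Type*} [MeasurableSpace α]
    {μ : Measure α} [IsFiniteMeasure μ] {f : ℕ → α → ℝ} (hf : ∀ n, MemLp (f n) 2 μ)
    (hvar : Tendsto (fun n => Var[f n; μ]) atTop (𝓝 0)) :
    ∃ ns : ℕ → ℕ, StrictMono ns ∧
      ∀ᵐ x ∂μ, Tendsto (fun n => f (ns n) x - ∫ y, f (ns n) y ∂μ) atTop (𝓝 0) := by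
  refine TendstoInMeasure.exists_seq_tendsto_ae (f := fun n x => f n x - ∫ y, f n y ∂μ)
    (tendstoInMeasure_iff_norm.2 fun c hc => ?_)
  have hbound : Tendsto (fun n => ENNReal.ofReal (Var[f n; μ] / c ^ 2)) atTop (𝓝 0) := by
    simpa using ENNReal.tendsto_ofReal (hvar.div_const (c ^ 2))
  refine tendsto_of_tendsto_of_tendsto_of_le_of_le tendsto_const_nhds hbound (fun _ => zero_le)
    fun n => ?_
  simpa only [Pi.zero_apply, sub_zero, Real.norm_eq_abs] using
    meas_ge_le_variance_div_sq (hf n) hc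

/-- Along a sequence of statistics `f` with vanishing variance, `s x = lim (E f - g (π x))`. -/
theorem exists_measurable_ae_eq_comp_of_variance_le {α β : Type*} [MeasurableSpace α]
    [MeasurableSpace β] {μ : Measure α} [IsFiniteMeasure μ] {π : α → β} {s : α → ℤ}
    (h : ∀ ε > 0, ∃ (f : α → ℝ) (g : β → ℝ), MemLp f 2 μ ∧ Measurable g ∧ Var[f; μ] ≤ ε ∧
      ∀ x, f x = g (π x) + s x) :
    ∃ N : β → ℤ, Measurable N ∧ ∀ᵐ x ∂μ, s x = N (π x) := by
  choose f g hf hg hvar hfg using fun n : ℕ => h (1 / ((n : ℝ) + 1)) (by positivity)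
  obtain ⟨ns, -, hlim⟩ := exists_seq_tendsto_ae_sub_integral_of_tendsto_variance hf
    (squeeze_zero (fun n => variance_nonneg _ _) hvar tendsto_one_div_add_atTop_nhds_zero_nat)
  refine ⟨fun y => ⌊limsup (fun n => ∫ x, f (ns n) x ∂μ - g (ns n) y) atTop⌋,
    (Measurable.limsup fun n => measurable_const.sub (hg (ns n))).floor, ?_⟩
  filter_upwards [hlim] with x hx
  have hs : Tendsto (fun n => ∫ x, f (ns n) x ∂μ - g (ns n) (π x)) atTop (𝓝 (s x)) := by
    refine (sub_zero (s x : ℝ) ▸ tendsto_const_nhds.sub hx).congr fun n => ?_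
    rw [hfg]
    ring
  rw [hs.limsup_eq, Int.floor_intCast]

variable {P : Measure Conf} {K : ℝ → ℝ → ℂ} {T : L2 →L[ℂ] L2} {B D : Set ℝ}

lemma count_eq_count_diff_add (X : Conf) (B : Set ℝ) (hb : Bornology.IsBounded D) :
    count D X = count D (X.diff B) + count (B ∩ D) X := by
  rw [count, count, count, ← Set.ncard_sdiff_add_ncard_of_subset
    (Set.inter_subset_inter_right X.carrier Set.inter_subset_right) (X.finite_inter hb)]
  congr 2
  ext y
  simp only [Conf.diff, Set.mem_sdiff, Set.mem_inter_iff]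
  tauto

lemma signedCount_eq_signedCount_diff_add (X : Conf) (B : Set ℝ) (hb : Bornology.IsBounded D) :
    signedCount D X = signedCount D (X.diff B) + signedCount (B ∩ D) X := by
  have hbs {E : Set ℝ} := hb.subset (Set.inter_subset_left (t := E))
  simp only [signedCount, Set.inter_assoc, count_eq_count_diff_add X B hbs, Nat.cast_add]
  ring

lemma signedCount_eq_sum_cell (X : Conf) (hb : Bornology.IsBounded B) {t : Finset ℤ}
    (ht : ∀ y ∈ B, ⌊y⌋ ∈ t) : signedCount B X = ∑ i ∈ t, signedCount (B ∩ cell 1 i) X := by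
  have hsum (E : Set ℝ) : count (B ∩ E) X = ∑ i ∈ t, count (B ∩ cell 1 i ∩ E) X := by
    simp only [Set.inter_right_comm B _ E]
    exact count_eq_sum_cell X (hb.subset Set.inter_subset_left) one_pos fun y hy => by
      simpa only [div_one] using ht y hy.1
  simp only [signedCount, hsum, Nat.cast_sum, Finset.sum_sub_distrib]

/-- The linear statistic of the step function `x ↦ sgn(x) h(⌊x⌋)`, that is
`∑ᵢ h(i) (#(X ∩ [i, i+1) ∩ ℝ₊) - #(X ∩ [i, i+1) ∩ ℝ₋))`. -/
noncomputable def signedStat (h : ℤ →₀ ℝ) (X : Conf) : ℝ :=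
  ∑ i ∈ h.support, h i * signedCount (cell 1 i) X

lemma measurable_signedStat (h : ℤ →₀ ℝ) : Measurable (signedStat h) :=
  Finset.measurable_fun_sum _ fun i _ =>
    (measurable_signedCount (measurableSet_cell 1 i) (isBounded_cell 1 i)).const_mul _

lemma signedStat_eq_signedStat_diff_add (X : Conf) (hb : Bornology.IsBounded B) {h : ℤ →₀ ℝ}
    (hB : ∀ y ∈ B, h ⌊y⌋ = 1) : signedStat h X = signedStat h (X.diff B) + signedCount B X := by
  have hsupp : ∀ y ∈ B, ⌊y⌋ ∈ h.support := fun y hy => by simp [hB y hy]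
  rw [signedCount_eq_sum_cell X hb hsupp]
  simp only [signedStat, ← Finset.sum_add_distrib]
  refine Finset.sum_congr rfl fun i _ => ?_
  rw [signedCount_eq_signedCount_diff_add X B (isBounded_cell 1 i), mul_add]
  congr 1
  rcases (B ∩ cell 1 i).eq_empty_or_nonempty with hempty | ⟨y, hyB, hyi⟩
  · simp [hempty, signedCount, count]
  · have hy : ⌊y⌋ = i := by simpa only [div_one] using (mem_cell_iff one_pos).1 hyi
    rw [← hy, hB y hyB, one_mul]

lemma HasClusterFunction.memLp_signedStat {G : ℝ × ℝ → ℝ} (hG : HasClusterFunction P G)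
    (h : ℤ →₀ ℝ) : MemLp (signedStat h) 2 P :=
  memLp_finsetSum _ fun i _ =>
    (hG.memLp_signedCount (measurableSet_cell 1 i) (isBounded_cell 1 i)).const_mul (h i)

lemma IsDeterminantal.variance_signedCount_le (hP : IsDeterminantal K P)
    (hK : IsJHermitianKernel K T) (hdiag : IsTraceDiagonal K T) (hT : IsStarProjection (hat T))
    (hD : MeasurableSet D) (hb : Bornology.IsBounded D) :
    Var[signedCount D; P] ≤ (∫ x in D, K x x).re - energy K D D := by
  have := hP.isProbabilityMeasure
  rw [← hP.integral_count_Ioi_add_Iio hdiag hD hb]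
  exact (hP.hasClusterFunction hK hdiag hT).variance_signedCount_le hK
    (hdiag.integrableOn_norm_sq hK.toIsIntegralKernel hT D hD hb) hD hb

lemma IsDeterminantal.covariance_signedCount_cell (hP : IsDeterminantal K P)
    (hK : IsJHermitianKernel K T) (hdiag : IsTraceDiagonal K T) (hT : IsStarProjection (hat T))
    (i j : ℤ) : cov[signedCount (cell 1 i), signedCount (cell 1 j); P] =
      (if i = j then Var[signedCount (cell 1 i); P] + energy K (cell 1 i) (cell 1 i) else 0) -
        energy K (cell 1 i) (cell 1 j) := by
  have := hP.isProbabilityMeasure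
  split_ifs with hij
  · rw [← hij, covariance_self (measurable_signedCount (measurableSet_cell 1 i)
      (isBounded_cell 1 i)).aemeasurable]
    ring
  · rw [(hP.hasClusterFunction hK hdiag hT).covariance_signedCount
      (hdiag.integrableOn_norm_sq hK.toIsIntegralKernel hT _ (measurableSet_cell 1 j)
        (isBounded_cell 1 j)) (measurableSet_cell 1 i) (isBounded_cell 1 i)
      (measurableSet_cell 1 j) (isBounded_cell 1 j) (pairwise_disjoint_cell one_pos hij)]
    ring

theorem IsDeterminantal.variance_signedStat_le (hP : IsDeterminantal K P)
    (hK : IsJHermitianKernel K T) (hdiag : IsTraceDiagonal K T) (hT : IsStarProjection (hat T))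
    (h : ℤ →₀ ℝ) :
    Var[signedStat h; P] ≤ dirichletForm (fun i j => energy K (cell 1 i) (cell 1 j))
      (fun i => (∫ x in cell 1 i, K x x).re) h h := by
  have := hP.isProbabilityMeasure
  have hL (i : ℤ) : MemLp (signedCount (cell 1 i)) 2 P :=
    (hP.hasClusterFunction hK hdiag hT).memLp_signedCount (measurableSet_cell 1 i)
      (isBounded_cell 1 i)
  unfold signedStat
  rw [variance_fun_sum' fun i _ => (hL i).const_mul (h i), dirichletForm_apply]
  refine Finset.sum_le_sum fun i hi => ?_
  calc ∑ j ∈ h.support, cov[fun X => h i * signedCount (cell 1 i) X,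
        fun X => h j * signedCount (cell 1 j) X; P]
      = h i * ((Var[signedCount (cell 1 i); P] + energy K (cell 1 i) (cell 1 i)) * h i -
          ∑ j ∈ h.support, h j * energy K (cell 1 i) (cell 1 j)) := by
        simp only [covariance_const_mul_left, covariance_const_mul_right,
          hP.covariance_signedCount_cell hK hdiag hT, Finset.mul_sum, mul_sub,
          Finset.sum_sub_distrib, mul_ite, mul_zero, Finset.sum_ite_eq, if_pos hi]
        ring_nf
    _ ≤ h i * ((∫ x in cell 1 i, K x x).re * h i -
          ∑ j ∈ h.support, h j * energy K (cell 1 i) (cell 1 j)) := by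
        have hvar := hP.variance_signedCount_le hK hdiag hT (measurableSet_cell 1 i)
          (isBounded_cell 1 i)
        nlinarith [mul_le_mul_of_nonneg_right hvar (mul_self_nonneg (h i))]

end Rigidity

end BalancedRigidity

open BalancedRigidity in
theorem mainTheorem4_general (K : ℝ → ℝ → ℂ) (T : L2 →L[ℂ] L2) (hK : IsJHermitianKernel K T)
    (hdiag : IsTraceDiagonal K T) (hT : IsStarProjection (hat T)) (M : ℝ) (Φ : ℝ → ℝ)
    (h0 : ∀ t, 0 ≤ Φ t) (hi : Integrable Φ)
    (hO : (fun R : ℝ => ∫ t in {t | R ≤ |t|}, Φ t) =O[atTop] fun R => R⁻¹)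
    (hΦ : ∀ x y : ℝ, M ≤ |x| → M ≤ |y| → ‖K x y‖ ^ 2 ≤ Φ (x - y))
    (P : Measure Conf) (hP : IsDeterminantal K P) (B : Set ℝ) (hb : Bornology.IsBounded B) :
    ∃ N : Conf → ℤ, Measurable N ∧
      ∀ᵐ X ∂P, (count (B ∩ Set.Ioi 0) X : ℤ) - (count (B ∩ Set.Iio 0) X : ℤ) = N (X.diff B) := by
  have := hP.isProbabilityMeasure
  obtain ⟨t, ht⟩ := exists_finset_floor_div_mem hb one_pos
  refine exists_measurable_ae_eq_comp_of_variance_le fun ε hε => ?_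
  obtain ⟨h, hone, hle⟩ :=
    hdiag.exists_finsupp_dirichletForm_energy_le hK hT h0 hi hO hΦ t hε
  refine ⟨signedStat h, signedStat h, (hP.hasClusterFunction hK hdiag hT).memLp_signedStat h,
    measurable_signedStat h, (hP.variance_signedStat_le hK hdiag hT h).trans hle, fun X => ?_⟩
  rw [signedStat_eq_signedStat_diff_add X hb fun y hy => hone _ (by simpa using ht y hy)]
  simp [signedCount]

theorem mainTheorem4 (K : ℝ → ℝ → ℂ) (T : BalancedRigidity.L2 →L[ℂ] BalancedRigidity.L2)
    (hK : BalancedRigidity.IsJHermitianKernel K T)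
    (hdiag : BalancedRigidity.IsTraceDiagonal K T)
    (h1 : BalancedRigidity.Condition1 T)
    (M : ℝ) (hM : 0 < M) (h2 : BalancedRigidity.Condition2 K M)
    (P : MeasureTheory.Measure BalancedRigidity.Conf)
    (hP : BalancedRigidity.IsDeterminantal K P)
    (B : Set ℝ) (hB : MeasurableSet B) (hBb : Bornology.IsBounded B) :
    ∃ N : BalancedRigidity.Conf → ℤ, Measurable N ∧
      ∀ᵐ X ∂P, (BalancedRigidity.count (B ∩ Set.Ioi 0) X : ℤ)
        - (BalancedRigidity.count (B ∩ Set.Iio 0) X : ℤ) = N (X.diff B) := by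
  obtain ⟨Φ, h0, hi, hO, hΦ⟩ := h2.decay
  exact mainTheorem4_general K T hK hdiag h1.projection M Φ h0 hi hO hΦ P hP B hBb
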